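/- **Notation.** For an entire function $f$ put $f^*(z)=\overline{f(\bar z)}$. An entire function $E$ is of Hermite–Biehler class if $|E(\bar z)|<|E(z)|$ whenever $\operatorname{Im} z>0$. For such $E$, the de Branges space $\mathcal H(E)$ is the Hilbert space of all entire functions $f$ with $\|f\|_E^2=\int_{\mathbb R}|f(t)/E(t)|^2\,dt<\infty$ such that $f/E$ and $f^*/E$ are of bounded type (quotients of bounded analytic functions) and of nonpositive mean type $\limsup_{y\to+\infty} y^{-1}\log|\cdot(iy)|$ in the upper half-plane, with inner product $\langle f,g\rangle_E=\int_{\mathbb R} f(t)\overline{g(t)}\,|E(t)|^{-2}\,dt$. Its reproducing kernel is $$K_E(w,z)=\frac{\overline{E(w)}E(z)-E(\bar w)E^*(z)}{2\pi i(\bar w-z)},$$ extended by continuity to $z=\bar w$. A phase function of $E$ is a continuous strictly increasing $\varphi:\mathbb R\to\mathbb R$ such that $E(x)e^{i\varphi(x)}\in\mathbb R$ for all $x\in\mathbb R$. A Parseval frame for a Hilbert space $\mathcal H$ is a family $(f_n)$ in $\mathcal H$ with $\sum_n|\langle f,f_n\rangle|^2=\|f\|^2$ for all $f\in\mathcal H$.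 Parseval frames $(u_n)$ of $\mathcal H_1$ and $(v_n)$ of $\mathcal H_2$ are orthogonal if $\sum_n\langle f,u_n\rangle v_n=0$ for all $f\in\mathcal H_1$ and $\sum_n\langle g,v_n\rangle u_n=0$ for all $g\in\mathcal H_2$. **Theorem.** Let $E$ and $F$ be of Hermite–Biehler class, let $\varphi_{EF}$ be a phase function of $EF$, and let $\alpha\in[0,\pi)$. Let $(\lambda_n)_{n\in\mathbb Z}$ be real numbers with $\varphi_{EF}(\lambda_n)=n\pi+\alpha$ for all $n\in\mathbb Z$, such that $\{K_{EF}(\lambda_n,\cdot)\}_{n\in\mathbb Z}$ is complete in $\mathcal H(EF)$, that is, has dense linear span. Then for every $f\in\mathcal H(E)$, $$\sum_{n\in\mathbb Z} f(\lambda_n)F(\lambda_n)\,\frac{E(\lambda_n)K_F(\lambda_n,\cdot)}{K_{EF}(\lambda_n,\lambda_n)}=0,$$ and for every $g\in\mathcal H(F)$, $$\sum_{n\in\mathbb Z} g(\lambda_n)E^*(\lambda_n)\,\frac{\overline{F(\lambda_n)}K_E(\lambda_n,\cdot)}{K_{EF}(\lambda_n,\lambda_n)}=0,$$ where the series converge unconditionally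 in the norms of $\mathcal H(F)$ and $\mathcal H(E)$, respectively. Consequently, the families $$\left\{\frac{\overline{F(\lambda_n)}K_E(\lambda_n,\cdot)}{\sqrt{K_{EF}(\lambda_n,\lambda_n)}}\right\}_{n\in\mathbb Z}\quad\text{and}\quad\left\{\frac{E(\lambda_n)K_F(\lambda_n,\cdot)}{\sqrt{K_{EF}(\lambda_n,\lambda_n)}}\right\}_{n\in\mathbb Z},$$ which are Parseval frames for $\mathcal H(E)$ and $\mathcal H(F)$, respectively, are orthogonal. -/

import Mathlib

open scoped ComplexConjugate

noncomputable section

namespace DeBranges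

open Filter Topology MeasureTheory

/-- `E` is an entire function of Hermite–Biehler class. -/
def HermiteBiehler (E : ℂ → ℂ) : Prop :=
  Differentiable ℂ E ∧ ∀ z : ℂ, 0 < z.im → ‖E (conj z)‖ < ‖E z‖

/-- The function `f^*(z) = conj (f (conj z))`. -/
def sharp (f : ℂ → ℂ) : ℂ → ℂ := fun z => conj (f (conj z))

/-- The open upper half-plane. -/
def upperHalf : Set ℂ := {z | 0 < z.im}

/-- `f` is analytic and of bounded type in the upper half-plane: `f = p / q` there, with `p`, `q`
bounded and analytic and `q` not identically zero. The quotient is written as `f * q = p`, so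
that `q` may vanish at isolated points. -/
def BoundedType (f : ℂ → ℂ) : Prop :=
  DifferentiableOn ℂ f upperHalf ∧
  ∃ p q : ℂ → ℂ, DifferentiableOn ℂ p upperHalf ∧ DifferentiableOn ℂ q upperHalf ∧
    (∃ C : ℝ, ∀ z ∈ upperHalf, ‖p z‖ ≤ C) ∧ (∃ C : ℝ, ∀ z ∈ upperHalf, ‖q z‖ ≤ C) ∧
    (∃ z ∈ upperHalf, q z ≠ 0) ∧ ∀ z ∈ upperHalf, f z * q z = p z

/-- The mean type of `f` in the upper half-plane, `limsup_{y → +∞} log |f(iy)| / y`, an extended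
real number (with `log 0 = -∞`). -/
def meanType (f : ℂ → ℂ) : EReal :=
  limsup (fun y : ℝ => ENNReal.log ‖f (y * Complex.I)‖ₑ / (y : EReal)) atTop

/-- The square of the norm of the de Branges space of `E`, as an extended nonnegative number. -/
def normSq (E f : ℂ → ℂ) : ENNReal := ∫⁻ t : ℝ, ‖f t / E t‖ₑ ^ 2

/-- The inner product of the de Branges space of `E`, linear in the first variable. -/
def inner (E f g : ℂ → ℂ) : ℂ := ∫ t : ℝ, f t * conj (g t) / ((‖E t‖ ^ 2 : ℝ) : ℂ)

/-- The set of functions of the de Branges space `H(E)`. -/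
def space (E : ℂ → ℂ) : Set (ℂ → ℂ) :=
  {f | Differentiable ℂ f ∧ normSq E f < ⊤ ∧
    BoundedType (fun z => f z / E z) ∧ meanType (fun z => f z / E z) ≤ 0 ∧
    BoundedType (fun z => sharp f z / E z) ∧ meanType (fun z => sharp f z / E z) ≤ 0}

/-- The numerator of the reproducing kernel. -/
def kernelNum (E : ℂ → ℂ) (w z : ℂ) : ℂ :=
  conj (E w) * E z - E (conj w) * sharp E z

/-- The reproducing kernel
`K_E(w, z) = (conj (E w) * E z - E (conj w) * E^* z) / (2πi (conj w - z))`. The numerator vanishes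
at `z = conj w`, where the quotient has a removable singularity; its value there is the limit,
minus the derivative of the numerator over `2πi`. -/
def kernel (E : ℂ → ℂ) (w z : ℂ) : ℂ :=
  if z = conj w then -deriv (kernelNum E w) (conj w) / (2 * Real.pi * Complex.I)
  else kernelNum E w z / (2 * Real.pi * Complex.I * (conj w - z))

/-- `φ` is a phase function of `E`: continuous, strictly increasing, and `E(x) e^{iφ(x)}` is real
for every real `x`. (When `E` has no real zeros, this says that `E(x) = |E(x)| e^{-iφ(x)}` for
all `x`, for `φ` or for `φ + π`.) -/
def IsPhaseFunction (E : ℂ → ℂ) (φ : ℝ → ℝ) : Prop :=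
  Continuous φ ∧ StrictMono φ ∧ ∀ x : ℝ, (E x * Complex.exp (Complex.I * φ x)).im = 0

/-- The linear span of the functions `u i` is dense in `H(E)`. -/
def IsCompleteSystem {ι : Type*} (E : ℂ → ℂ) (u : ι → ℂ → ℂ) : Prop :=
  ∀ h ∈ space E, ∀ ε > 0, ∃ g ∈ Submodule.span ℂ (Set.range u), normSq E (h - g) < ε

/-- The series `∑ i, u i` of elements of `H(E)` converges unconditionally, in the norm of `H(E)`,
to the element `s` of `H(E)`. -/
def HasSumIn {ι : Type*} (E : ℂ → ℂ) (u : ι → ℂ → ℂ) (s : ℂ → ℂ) : Prop :=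
  (∀ i, u i ∈ space E) ∧ s ∈ space E ∧
    Tendsto (fun T : Finset ι => normSq E (∑ i ∈ T, u i - s)) atTop (𝓝 0)

/-- `u` is a Parseval frame for `H(E)`. -/
def IsParsevalFrame {ι : Type*} (E : ℂ → ℂ) (u : ι → ℂ → ℂ) : Prop :=
  (∀ i, u i ∈ space E) ∧ ∀ f ∈ space E, ∑' i, ‖inner E f (u i)‖ₑ ^ 2 = normSq E f

/-- The composition of the synthesis operator of `v` (a system in `H(F)`) with the analysis
operator of `u` (a system in `H(E)`) is zero. -/
def SynthesisAnalysisZero {ι : Type*} (E F : ℂ → ℂ) (u v : ι → ℂ → ℂ) : Prop :=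
  ∀ f ∈ space E, HasSumIn F (fun i => inner E f (u i) • v i) 0

/-- Systems `u` in `H(E)` and `v` in `H(F)` are orthogonal. -/
def IsOrthogonalPair {ι : Type*} (E F : ℂ → ℂ) (u v : ι → ℂ → ℂ) : Prop :=
  SynthesisAnalysisZero E F u v ∧ SynthesisAnalysisZero F E v u

/-- The system `conj (F(λ_n)) K_E(λ_n, ·) / √K_{EF}(λ_n, λ_n)`. -/
def frameE (E F : ℂ → ℂ) (lam : ℤ → ℝ) (n : ℤ) : ℂ → ℂ := fun z =>
  conj (F (lam n)) * kernel E (lam n) z / (√(kernel (E * F) (lam n) (lam n)).re : ℝ)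

/-- The system `E(λ_n) K_F(λ_n, ·) / √K_{EF}(λ_n, λ_n)`. -/
def frameF (E F : ℂ → ℂ) (lam : ℤ → ℝ) (n : ℤ) : ℂ → ℂ := fun z =>
  E (lam n) * kernel F (lam n) z / (√(kernel (E * F) (lam n) (lam n)).re : ℝ)

end DeBranges

end

/-!
A quotient `N / D` that is integrable on the real line, of bounded type and of nonpositive mean
type in the upper half-plane extends analytically to the closed half-plane, lies in the Hardy class
`H¹`, and therefore has integral zero. Applied to the difference quotients of `f / E` and `f^* / E`
at a real point, this yields the reproducing property of `K_E`; applied to `f^* g / (E F)`, it shows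
that `f F` and `g E^*` are orthogonal in `H(E F)` for all `f` in `H(E)` and `g` in `H(F)`.

On a level set of the phase modulo `π` the kernels `K_{E F}(λ_n, ·)` are pairwise orthogonal, so
once normalized they form an orthonormal basis of `H(E F)`, up to vanishing members. The maps
`f ↦ f F` and `g ↦ g E^*` embed `H(E)` and `H(F)` isometrically into `H(E F)` with orthogonal
ranges, and the two frames are the projections of this basis to the ranges. Projections of an
orthonormal basis to orthogonal subspaces are orthogonal Parseval frames.
-/

namespace HardyDisc

open Filter Topology MeasureTheory Metric Set Real InnerProductSpace

section PoissonIntegral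

/-- The Poisson integral at `w` of the function `u` on the circle of radius `R` about `0`. -/
noncomputable def poissonIntegral (R : ℝ) (u : ℂ → ℝ) (w : ℂ) : ℝ :=
  circleAverage (poissonKernel 0 w * u) 0 R

variable {R : ℝ} {w : ℂ} {u v : ℂ → ℝ}

theorem circleAverage_const_mul (a : ℝ) (u : ℂ → ℝ) (c : ℂ) (R : ℝ) :
    circleAverage (fun z ↦ a * u z) c R = a * circleAverage u c R := by
  simp only [← smul_eq_mul, circleAverage_fun_smul]

theorem sphere_abs_radius (hw : w ∈ ball (0 : ℂ) R) : sphere (0 : ℂ) |R| = sphere 0 R := by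
  rw [abs_of_pos (pos_of_mem_ball hw)]

theorem sub_div_add_le_poissonKernel {z : ℂ} (hw : w ∈ ball (0 : ℂ) R)
    (hz : z ∈ sphere (0 : ℂ) R) : (R - ‖w‖) / (R + ‖w‖) ≤ poissonKernel 0 w z := by
  have h := le_re_herglotzRieszKernel hz hw
  rw [poissonKernel_eq_re_herglotzRieszKernel]
  simpa [herglotzRieszKernel_def] using h

theorem poissonKernel_nonneg {z : ℂ} (hw : w ∈ ball (0 : ℂ) R) (hz : z ∈ sphere (0 : ℂ) R) :
    0 ≤ poissonKernel 0 w z := by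
  have hwR : ‖w‖ < R := by simpa using hw
  refine le_trans (div_nonneg ?_ ?_) (sub_div_add_le_poissonKernel hw hz) <;>
    linarith [norm_nonneg w]

theorem continuousOn_poissonKernel_sphere (hw : w ∈ ball (0 : ℂ) R) :
    ContinuousOn (poissonKernel 0 w) (sphere 0 |R|) := by
  rw [poissonKernel_eq_re_herglotzRieszKernel]
  exact Complex.continuous_re.comp_continuousOn (continuousOn_herglotzRieszKernel_sphere hw)

theorem circleIntegrable_poissonKernel_mul (hw : w ∈ ball (0 : ℂ) R)
    (hu : CircleIntegrable u 0 R) : CircleIntegrable (poissonKernel 0 w * u) 0 R :=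
  IntervalIntegrable.continuousOn_mul hu
    ((continuousOn_poissonKernel_sphere hw).comp_continuous (continuous_circleMap 0 R)
      (circleMap_mem_sphere' 0 R)).continuousOn

theorem poissonIntegral_mono (hw : w ∈ ball (0 : ℂ) R) (hu : CircleIntegrable u 0 R)
    (hv : CircleIntegrable v 0 R) (h : ∀ z ∈ sphere (0 : ℂ) R, u z ≤ v z) :
    poissonIntegral R u w ≤ poissonIntegral R v w := by
  refine circleAverage_mono (circleIntegrable_poissonKernel_mul hw hu)
    (circleIntegrable_poissonKernel_mul hw hv) fun z hz ↦ ?_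
  rw [sphere_abs_radius hw] at hz
  exact mul_le_mul_of_nonneg_left (h z hz) (poissonKernel_nonneg hw hz)

theorem poissonIntegral_nonneg (hw : w ∈ ball (0 : ℂ) R) (h : ∀ z ∈ sphere (0 : ℂ) R, 0 ≤ u z) :
    0 ≤ poissonIntegral R u w := by
  refine circleAverage_nonneg_of_nonneg fun z hz ↦ ?_
  rw [sphere_abs_radius hw] at hz
  exact mul_nonneg (poissonKernel_nonneg hw hz) (h z hz)

theorem poissonIntegral_add (hw : w ∈ ball (0 : ℂ) R) (hu : CircleIntegrable u 0 R)
    (hv : CircleIntegrable v 0 R) :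
    poissonIntegral R (u + v) w = poissonIntegral R u w + poissonIntegral R v w := by
  rw [poissonIntegral, mul_add]
  exact circleAverage_add (circleIntegrable_poissonKernel_mul hw hu)
    (circleIntegrable_poissonKernel_mul hw hv)

theorem poissonIntegral_const_mul (c : ℝ) :
    poissonIntegral R (fun z ↦ c * u z) w = c * poissonIntegral R u w := by
  rw [poissonIntegral, poissonIntegral, ← circleAverage_const_mul]
  congr 1
  ext z
  simp only [Pi.mul_apply]
  ring

theorem poissonIntegral_sum {ι : Type*} {s : Finset ι} {f : ι → ℂ → ℝ} (hw : w ∈ ball (0 : ℂ) R)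
    (hf : ∀ i ∈ s, CircleIntegrable (f i) 0 R) :
    poissonIntegral R (∑ i ∈ s, f i) w = ∑ i ∈ s, poissonIntegral R (f i) w := by
  rw [poissonIntegral, Finset.mul_sum]
  exact circleAverage_sum fun i hi ↦ circleIntegrable_poissonKernel_mul hw (hf i hi)

theorem poissonIntegral_of_harmonic (hw : w ∈ ball (0 : ℂ) R)
    (hu : HarmonicOnNhd u (closedBall 0 R)) : poissonIntegral R u w = u w :=
  HarmonicOnNhd.circleAverage_poissonKernel_smul hu hw

theorem poissonIntegral_const (hw : w ∈ ball (0 : ℂ) R) (c : ℝ) :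
    poissonIntegral R (fun _ ↦ c) w = c :=
  poissonIntegral_of_harmonic hw fun _ _ ↦ harmonicAt_const c

theorem poissonIntegral_congr_sphere (hw : w ∈ ball (0 : ℂ) R)
    (h : ∀ z ∈ sphere (0 : ℂ) R, u z = v z) :
    poissonIntegral R u w = poissonIntegral R v w := by
  refine circleAverage_congr_sphere fun z hz ↦ ?_
  rw [sphere_abs_radius hw] at hz
  simp only [Pi.mul_apply, h z hz]

theorem poissonIntegral_congr_codiscreteWithin (hw : w ∈ ball (0 : ℂ) R)
    (h : u =ᶠ[codiscreteWithin (closedBall (0 : ℂ) R)] v) :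
    poissonIntegral R u w = poissonIntegral R v w := by
  refine circleAverage_congr_codiscreteWithin ?_ (pos_of_mem_ball hw).ne'
  rw [sphere_abs_radius hw]
  filter_upwards [codiscreteWithin_mono sphere_subset_closedBall h] with z hz
  simp only [Pi.mul_apply, hz]

theorem exp_poissonIntegral_le (hw : w ∈ ball (0 : ℂ) R) (hu : CircleIntegrable u 0 R)
    (hexp : CircleIntegrable (fun z ↦ exp (u z)) 0 R) :
    exp (poissonIntegral R u w) ≤ poissonIntegral R (fun z ↦ exp (u z)) w := by
  set a := poissonIntegral R u w with ha
  have hshift : CircleIntegrable ((fun _ ↦ 1 - a) + u) 0 R :=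
    (circleIntegrable_const _ 0 R).add hu
  have htangent : ∀ x, exp a * (1 - a + x) ≤ exp x := fun x ↦ by
    have h := mul_le_mul_of_nonneg_left (add_one_le_exp (x - a)) (exp_pos a).le
    rw [← exp_add, add_sub_cancel] at h
    linarith
  calc exp a = poissonIntegral R (fun z ↦ exp a * ((fun _ ↦ 1 - a) + u : ℂ → ℝ) z) w := by
        rw [poissonIntegral_const_mul, poissonIntegral_add hw (circleIntegrable_const _ 0 R) hu,
          poissonIntegral_const hw, ← ha]
        ring
    _ ≤ poissonIntegral R (fun z ↦ exp (u z)) w :=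
        poissonIntegral_mono hw (hshift.const_mul _) hexp fun z _ ↦ htangent (u z)

end PoissonIntegral

section PoissonJensen

variable {R : ℝ} {w : ℂ}

theorem norm_sub_le_norm_sq_sub_conj_mul_div {u : ℂ} (hw : w ∈ ball (0 : ℂ) R)
    (hu : u ∈ closedBall (0 : ℂ) R) : ‖w - u‖ ≤ ‖((R : ℂ) ^ 2 - conj u * w) / R‖ := by
  have hR : 0 < R := pos_of_mem_ball hw
  have hwR : ‖w‖ < R := by simpa using hw
  have huR : ‖u‖ ≤ R := by simpa using hu
  have hident : Complex.normSq ((R : ℂ) ^ 2 - conj u * w) - Complex.normSq (w - u) * R ^ 2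
      = (R ^ 2 - ‖u‖ ^ 2) * (R ^ 2 - ‖w‖ ^ 2) := by
    simp only [← Complex.normSq_eq_norm_sq]
    simp [Complex.normSq_apply, pow_two]
    ring
  have hnonneg : 0 ≤ (R ^ 2 - ‖u‖ ^ 2) * (R ^ 2 - ‖w‖ ^ 2) := by
    apply mul_nonneg <;> nlinarith [norm_nonneg u, norm_nonneg w]
  rw [norm_div, Complex.norm_real, norm_of_nonneg hR.le, le_div_iff₀ hR,
    ← sq_le_sq₀ (by positivity) (norm_nonneg _), mul_pow, ← Complex.normSq_eq_norm_sq,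
    ← Complex.normSq_eq_norm_sq]
  linarith

theorem norm_sub_eq_norm_sq_sub_conj_mul_div {u z : ℂ} (hu : u ∈ ball (0 : ℂ) R)
    (hz : z ∈ sphere (0 : ℂ) R) : ‖z - u‖ = ‖((R : ℂ) ^ 2 - conj u * z) / R‖ := by
  have hR : R ≠ 0 := (pos_of_mem_ball hu).ne'
  have hzu : z - u ≠ 0 := sub_ne_zero.2 (ne_of_mem_of_not_mem hu fun h ↦
    (mem_ball.1 h).ne (mem_sphere.1 hz)).symm
  have h := Complex.norm_canonicalFactor_eval_circle_eq_one hu hz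
  rw [Complex.canonicalFactor_apply, norm_div, norm_mul,
    div_eq_one_iff_eq (by simp [hR, hzu])] at h
  rw [norm_div, h, mul_div_cancel_left₀ _ (by simp [hR])]

theorem sq_sub_conj_mul_ne_zero {u z : ℂ} (hu : u ∈ ball (0 : ℂ) R)
    (hz : z ∈ closedBall (0 : ℂ) R) : (R : ℂ) ^ 2 - conj u * z ≠ 0 := by
  intro h
  have hR : 0 < R := pos_of_mem_ball hu
  have huR : ‖u‖ < R := by simpa using hu
  have hzR : ‖z‖ ≤ R := by simpa using hz
  have hnorm : R ^ 2 = ‖u‖ * ‖z‖ := by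
    simpa [abs_of_pos hR] using congrArg norm (sub_eq_zero.1 h)
  nlinarith [norm_nonneg u, norm_nonneg z]

theorem log_norm_sub_le_poissonIntegral {u : ℂ} (hw : w ∈ ball (0 : ℂ) R)
    (hu : u ∈ closedBall (0 : ℂ) R) (hne : w ≠ u) :
    log ‖w - u‖ ≤ poissonIntegral R (fun z ↦ log ‖z - u‖) w := by
  rcases eq_or_lt_of_le (mem_closedBall_zero_iff.1 hu) with huR | huR
  · rw [poissonIntegral, poissonKernel_eq_re_herglotzRieszKernel,
      circleAverage_re_herglotzRieszKernel_mul_log (by simpa using huR) hw]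
  · have hR : (R : ℂ) ≠ 0 := mod_cast (pos_of_mem_ball hw).ne'
    replace huR : u ∈ ball (0 : ℂ) R := by simpa using huR
    have hharm : HarmonicOnNhd (fun z : ℂ ↦ log ‖((R : ℂ) ^ 2 - conj u * z) / R‖)
        (closedBall 0 R) := fun z hz ↦ by
      refine AnalyticAt.harmonicAt_log_norm (by fun_prop (disch := exact hR)) ?_
      exact div_ne_zero (sq_sub_conj_mul_ne_zero huR hz) hR
    rw [poissonIntegral_congr_sphere hw fun z hz ↦
      congrArg log (norm_sub_eq_norm_sq_sub_conj_mul_div huR hz),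
      poissonIntegral_of_harmonic hw hharm]
    exact log_le_log (norm_pos_iff.2 (sub_ne_zero.2 hne))
      (norm_sub_le_norm_sq_sub_conj_mul_div hw hu)

theorem accPt_closedBall_of_mem_ball (hw : w ∈ ball (0 : ℂ) R) :
    AccPt w (𝓟 (closedBall (0 : ℂ) R)) := by
  refine accPt_iff_frequently_nhdsNE.mpr (Eventually.frequently ?_)
  exact eventually_nhdsWithin_of_eventually_nhds
    (mem_of_superset (isOpen_ball.mem_nhds hw) ball_subset_closedBall)

theorem exists_log_norm_eq_sum_add_log_norm {f : ℂ → ℂ} (hw : w ∈ ball (0 : ℂ) R)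
    (hf : AnalyticOnNhd ℂ f (closedBall 0 R)) (hfw : f w ≠ 0) :
    ∃ (Z : Finset ℂ) (m : ℂ → ℝ) (g : ℂ → ℂ), AnalyticOnNhd ℂ g (closedBall 0 R) ∧
      (∀ z ∈ closedBall 0 R, g z ≠ 0) ∧ (∀ u ∈ Z, u ∈ closedBall 0 R ∧ u ≠ w ∧ 0 ≤ m u) ∧
      log ‖f w‖ = ∑ u ∈ Z, m u * log ‖w - u‖ + log ‖g w‖ ∧
      (fun z ↦ log ‖f z‖) =ᶠ[codiscreteWithin (closedBall (0 : ℂ) R)]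
        ((∑ u ∈ Z, fun z ↦ m u * log ‖z - u‖) + fun z ↦ log ‖g z‖) := by
  have hwc := ball_subset_closedBall hw
  have hmero := hf.meromorphicOn
  have horder_w : meromorphicOrderAt f w = 0 :=
    (hf w hwc).meromorphicNFAt.meromorphicOrderAt_eq_zero_iff.2 hfw
  have horder : ∀ u : closedBall (0 : ℂ) R, meromorphicOrderAt f u ≠ ⊤ := by
    rw [← hmero.exists_meromorphicOrderAt_ne_top_iff_forall
      ⟨⟨w, hwc⟩, (convex_closedBall 0 R).isPreconnected⟩]
    exact ⟨⟨w, hwc⟩, by simp [horder_w]⟩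
  set D := MeromorphicOn.divisor f (closedBall (0 : ℂ) R) with hD
  have hfin : D.support.Finite := D.finiteSupport (isCompact_closedBall 0 R)
  obtain ⟨g, hg, hg0, hfg⟩ := hmero.extract_zeros_poles horder hfin
  have hlog := MeromorphicOn.extract_zeros_poles_log hg0 hfg
  have hlog_w := MeromorphicOn.log_norm_meromorphicTrailingCoeffAt_extract_zeros_poles hfin hwc
    (accPt_closedBall_of_mem_ball hw) (hmero w hwc) (hg w hwc) (hg0 ⟨w, hwc⟩) hfg
  rw [(hf w hwc).meromorphicTrailingCoeffAt_of_ne_zero hfw] at hlog_w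
  rw [finsum_eq_sum_of_support_subset (s := hfin.toFinset) _ fun u ↦ by
    contrapose; aesop] at hlog hlog_w
  refine ⟨hfin.toFinset, fun u ↦ D u, g, hg, fun z hz ↦ hg0 ⟨z, hz⟩, fun u hu ↦ ?_, hlog_w, hlog⟩
  have hDu : D u ≠ 0 := by simpa using hu
  refine ⟨D.supportWithinDomain hDu, ?_,
    Int.cast_nonneg (MeromorphicOn.AnalyticOnNhd.divisor_nonneg hf u)⟩
  rintro rfl
  simp [hD, MeromorphicOn.divisor_apply hmero hwc, horder_w] at hDu

theorem log_norm_le_poissonIntegral {f : ℂ → ℂ} (hw : w ∈ ball (0 : ℂ) R)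
    (hf : AnalyticOnNhd ℂ f (closedBall 0 R)) (hfw : f w ≠ 0) :
    log ‖f w‖ ≤ poissonIntegral R (fun z ↦ log ‖f z‖) w := by
  obtain ⟨Z, m, g, hg, hg0, hZ, hfw_eq, hf_eq⟩ := exists_log_norm_eq_sum_add_log_norm hw hf hfw
  have hint : ∀ u, CircleIntegrable (fun z : ℂ ↦ m u * log ‖z - u‖) 0 R := fun u ↦
    (MeromorphicOn.circleIntegrable_log_norm (f := fun z ↦ z - u)
      (fun z _ ↦ by fun_prop)).const_mul _
  have hg_harm : HarmonicOnNhd (fun z ↦ log ‖g z‖) (closedBall 0 R) := fun z hz ↦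
    (hg z hz).harmonicAt_log_norm (hg0 z hz)
  have hg_int : CircleIntegrable (fun z ↦ log ‖g z‖) 0 R :=
    (hg.mono (by rw [sphere_abs_radius hw]; exact sphere_subset_closedBall)
      ).meromorphicOn.circleIntegrable_log_norm
  calc log ‖f w‖ = ∑ u ∈ Z, m u * log ‖w - u‖ + log ‖g w‖ := hfw_eq
    _ ≤ ∑ u ∈ Z, m u * poissonIntegral R (fun z ↦ log ‖z - u‖) w + log ‖g w‖ := by
      gcongr with u hu
      · exact (hZ u hu).2.2
      · exact log_norm_sub_le_poissonIntegral hw (hZ u hu).1 (hZ u hu).2.1.symm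
    _ = poissonIntegral R (fun z ↦ log ‖f z‖) w := by
      rw [poissonIntegral_congr_codiscreteWithin hw hf_eq,
        poissonIntegral_add hw (CircleIntegrable.sum _ fun u _ ↦ hint u) hg_int,
        poissonIntegral_sum hw fun u _ ↦ hint u, poissonIntegral_of_harmonic hw hg_harm]
      simp only [poissonIntegral_const_mul]

theorem posLog_norm_le_poissonIntegral {f : ℂ → ℂ} (hw : w ∈ ball (0 : ℂ) R)
    (hf : AnalyticOnNhd ℂ f (closedBall 0 R)) :
    log⁺ ‖f w‖ ≤ poissonIntegral R (fun z ↦ log⁺ ‖f z‖) w := by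
  have hmero : MeromorphicOn f (sphere 0 |R|) :=
    (hf.mono (by rw [sphere_abs_radius hw]; exact sphere_subset_closedBall)).meromorphicOn
  refine max_le (poissonIntegral_nonneg hw fun z _ ↦ posLog_nonneg) ?_
  rcases eq_or_ne (f w) 0 with hfw | hfw
  · simpa [hfw] using poissonIntegral_nonneg hw fun z _ ↦ posLog_nonneg
  · exact (log_norm_le_poissonIntegral hw hf hfw).trans (poissonIntegral_mono hw
      hmero.circleIntegrable_log_norm hmero.circleIntegrable_posLog_norm
      fun z _ ↦ le_max_right _ _)

end PoissonJensen

section BoundedCharacteristic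

variable {R r : ℝ} {w : ℂ} {k p q : ℂ → ℂ}

theorem circleAverage_neg_log_norm_le (hw : w ∈ ball (0 : ℂ) r)
    (hq : AnalyticOnNhd ℂ q (closedBall 0 r)) (hq1 : ∀ z ∈ sphere (0 : ℂ) r, ‖q z‖ ≤ 1)
    (hqw : q w ≠ 0) :
    circleAverage (fun z ↦ -log ‖q z‖) 0 r ≤ -log ‖q w‖ / ((r - ‖w‖) / (r + ‖w‖)) := by
  have hwr : ‖w‖ < r := by simpa using hw
  have hint : CircleIntegrable (fun z ↦ -log ‖q z‖) 0 r :=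
    (MeromorphicOn.circleIntegrable_log_norm (hq.mono (by
      rw [sphere_abs_radius hw]; exact sphere_subset_closedBall)).meromorphicOn).neg
  set κ := (r - ‖w‖) / (r + ‖w‖)
  have hκ_pos : 0 < κ := div_pos (by linarith) (by linarith [norm_nonneg w])
  rw [le_div_iff₀ hκ_pos, mul_comm]
  calc κ * circleAverage (fun z ↦ -log ‖q z‖) 0 r
      = circleAverage (fun z ↦ κ * -log ‖q z‖) 0 r := (circleAverage_const_mul ..).symm
    _ ≤ poissonIntegral r (fun z ↦ -log ‖q z‖) w := by
      refine circleAverage_mono (hint.const_mul κ) (circleIntegrable_poissonKernel_mul hw hint)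
        fun z hz ↦ ?_
      rw [sphere_abs_radius hw] at hz
      exact mul_le_mul_of_nonneg_right (sub_div_add_le_poissonKernel hw hz)
        (neg_nonneg.2 (log_nonpos (norm_nonneg _) (hq1 z hz)))
    _ = -poissonIntegral r (fun z ↦ log ‖q z‖) w := by
      simpa using poissonIntegral_const_mul (R := r) (w := w) (u := fun z ↦ log ‖q z‖) (-1)
    _ ≤ -log ‖q w‖ := neg_le_neg (log_norm_le_poissonIntegral hw hq hqw)

theorem posLog_norm_le_neg_log_norm {a b : ℂ} (hb : b ≠ 0) (hb1 : ‖b‖ ≤ 1) (hab : ‖a * b‖ ≤ 1) :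
    log⁺ ‖a‖ ≤ -log ‖b‖ := by
  have hb0 : 0 < ‖b‖ := norm_pos_iff.2 hb
  rw [norm_mul, ← le_div_iff₀ hb0, one_div] at hab
  rw [← log_inv, ← posLog_eq_log (by
    rw [abs_of_pos (inv_pos.2 hb0)]; exact (one_le_inv₀ hb0).2 hb1)]
  exact posLog_le_posLog (norm_nonneg a) hab

theorem circleAverage_posLog_norm_le (hw : w ∈ ball (0 : ℂ) r)
    (hk : AnalyticOnNhd ℂ k (closedBall 0 r)) (hq : AnalyticOnNhd ℂ q (closedBall 0 r))
    (hkq1 : ∀ z ∈ sphere (0 : ℂ) r, ‖k z * q z‖ ≤ 1) (hq1 : ∀ z ∈ sphere (0 : ℂ) r, ‖q z‖ ≤ 1)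
    (hqw : q w ≠ 0) :
    circleAverage (fun z ↦ log⁺ ‖k z‖) 0 r ≤ circleAverage (fun z ↦ -log ‖q z‖) 0 r := by
  classical
  have hr : 0 < r := pos_of_mem_ball hw
  have hsub : sphere (0 : ℂ) |r| ⊆ closedBall 0 r := by
    rw [sphere_abs_radius hw]; exact sphere_subset_closedBall
  have hne : {z | q z ≠ 0} ∈ codiscreteWithin (sphere (0 : ℂ) |r|) :=
    codiscreteWithin_mono hsub (hq.preimage_zero_mem_codiscreteWithin hqw
      (ball_subset_closedBall hw)
      ⟨⟨w, ball_subset_closedBall hw⟩, (convex_closedBall (0 : ℂ) r).isPreconnected⟩)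
  have hcongr : (fun z ↦ log⁺ ‖k z‖) =ᶠ[codiscreteWithin (sphere (0 : ℂ) |r|)]
      fun z ↦ if q z = 0 then 0 else log⁺ ‖k z‖ := by
    filter_upwards [hne] with z hz using (if_neg hz).symm
  rw [circleAverage_congr_codiscreteWithin hcongr hr.ne']
  refine circleAverage_mono
    ((hk.mono hsub).meromorphicOn.circleIntegrable_posLog_norm.congr_codiscreteWithin hcongr)
    (hq.mono hsub).meromorphicOn.circleIntegrable_log_norm.neg fun z hz ↦ ?_
  rw [sphere_abs_radius hw] at hz
  split_ifs with h
  · simp [h]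
  · exact posLog_norm_le_neg_log_norm h (hq1 z hz) (hkq1 z hz)

theorem exists_circleAverage_posLog_norm_le (hk : DifferentiableOn ℂ k (ball 0 R))
    (hq : DifferentiableOn ℂ q (ball 0 R)) (hkq1 : ∀ z ∈ ball (0 : ℂ) R, ‖k z * q z‖ ≤ 1)
    (hq1 : ∀ z ∈ ball (0 : ℂ) R, ‖q z‖ ≤ 1) (hw : w ∈ ball (0 : ℂ) R) (hqw : q w ≠ 0) :
    ∃ M, ∀ᶠ r in 𝓝[<] R, circleAverage (fun z ↦ log⁺ ‖k z‖) 0 r ≤ M := by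
  have hwR : ‖w‖ < R := by simpa using hw
  have hlog : 0 ≤ -log ‖q w‖ := neg_nonneg.2 (log_nonpos (norm_nonneg _) (hq1 w hw))
  obtain ⟨ρ, hwρ, hρR⟩ := exists_between hwR
  refine ⟨-log ‖q w‖ / ((ρ - ‖w‖) / (R + ‖w‖)), ?_⟩
  filter_upwards [Ioo_mem_nhdsLT hρR] with r ⟨hρr, hrR⟩
  have hw_r : w ∈ ball (0 : ℂ) r := by simpa using hwρ.trans hρr
  have hsub : closedBall (0 : ℂ) r ⊆ ball 0 R := closedBall_subset_ball hrR
  have hqr := (hq.analyticOnNhd isOpen_ball).mono hsub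
  have hsphere : sphere (0 : ℂ) r ⊆ ball 0 R := sphere_subset_closedBall.trans hsub
  refine (circleAverage_posLog_norm_le hw_r ((hk.analyticOnNhd isOpen_ball).mono hsub) hqr
    (fun z hz ↦ hkq1 z (hsphere hz)) (fun z hz ↦ hq1 z (hsphere hz)) hqw).trans
    ((circleAverage_neg_log_norm_le hw_r hqr (fun z hz ↦ hq1 z (hsphere hz)) hqw).trans ?_)
  have hw0 := norm_nonneg w
  have hpos : 0 < (ρ - ‖w‖) / (R + ‖w‖) := div_pos (by linarith) (by linarith)
  gcongr
  · linarith
  · linarith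

end BoundedCharacteristic

section RadialLimit

variable {R ρ : ℝ} {w ζ : ℂ} {u : ℂ → ℝ}

theorem circleMap_mem_closedBall_sdiff_ball {r : ℝ} (hρ : 0 ≤ ρ) (hr : r ∈ Icc ρ R) (θ : ℝ) :
    circleMap 0 r θ ∈ closedBall (0 : ℂ) R \ ball 0 ρ := by
  simpa [abs_of_nonneg (hρ.trans hr.1)] using And.intro hr.2 hr.1

theorem tendsto_circleAverage_nhdsLT {E : Type*} [NormedAddCommGroup E] [NormedSpace ℝ E]
    {f : ℂ → E} {B : ℝ} {S : Set ℂ} (hρ : 0 ≤ ρ) (hρR : ρ < R) (hS : S.Countable)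
    (hSR : S ⊆ sphere 0 R) (hf : ContinuousOn f ((closedBall 0 R \ ball 0 ρ) \ S))
    (hB : ∀ z ∈ (closedBall 0 R \ ball 0 ρ) \ S, ‖f z‖ ≤ B) :
    Tendsto (circleAverage f 0) (𝓝[<] R) (𝓝 (circleAverage f 0 R)) := by
  have hR : 0 < R := hρ.trans_lt hρR
  have hmem : ∀ r ∈ Ioo ρ R, ∀ θ, circleMap 0 r θ ∈ (closedBall (0 : ℂ) R \ ball 0 ρ) \ S := by
    refine fun r hr θ ↦ ⟨circleMap_mem_closedBall_sdiff_ball hρ ⟨hr.1.le, hr.2.le⟩ θ, fun h ↦ ?_⟩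
    have hnorm := mem_sphere_zero_iff_norm.1 (hSR h)
    rw [norm_circleMap_zero, abs_of_pos (hρ.trans_lt hr.1)] at hnorm
    exact hr.2.ne hnorm
  have hSθ : ∀ᵐ θ : ℝ, circleMap 0 R θ ∉ S :=
    (hS.preimage_circleMap 0 hR.ne').ae_notMem volume
  refine Tendsto.const_smul (intervalIntegral.tendsto_integral_filter_of_dominated_convergence
    (fun _ ↦ B) ?_ ?_ intervalIntegrable_const ?_) _
  · filter_upwards [Ioo_mem_nhdsLT hρR] with r hr
    exact (hf.comp_continuous (continuous_circleMap 0 r) (hmem r hr)).aestronglyMeasurable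
  · filter_upwards [Ioo_mem_nhdsLT hρR] with r hr
    exact Eventually.of_forall fun θ _ ↦ hB _ (hmem r hr θ)
  · filter_upwards [hSθ] with θ hθ _
    have hradius : Continuous fun r : ℝ ↦ circleMap 0 r θ := by unfold circleMap; fun_prop
    refine (hf _ ⟨circleMap_mem_closedBall_sdiff_ball hρ ⟨hρR.le, le_rfl⟩ θ, hθ⟩).tendsto.comp
      (tendsto_nhdsWithin_of_tendsto_nhds_of_eventually_within _
        (hradius.continuousAt.tendsto.mono_left nhdsWithin_le_nhds) ?_)
    filter_upwards [Ioo_mem_nhdsLT hρR] with r hr using hmem r hr θ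

theorem continuousAt_poissonKernel {z : ℂ} (h : z ≠ w) : ContinuousAt (poissonKernel 0 w) z := by
  have heq : poissonKernel 0 w = fun z ↦ (‖z - 0‖ ^ 2 - ‖w - 0‖ ^ 2) / ‖z - 0 - (w - 0)‖ ^ 2 :=
    funext fun z ↦ poissonKernel_def 0 w z
  have hne : ‖z - 0 - (w - 0)‖ ^ 2 ≠ 0 := by simpa [sub_eq_zero] using h
  rw [heq]
  fun_prop (disch := exact hne)

theorem continuousOn_poissonKernel_cutoff_mul {c : ℝ} (hwρ : ‖w‖ < ρ)
    (hζ : ‖w‖ < ‖ζ‖) (hc : poissonKernel 0 w ζ < c) (hu : ContinuousOn u (closedBall 0 R \ {ζ})) :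
    ContinuousOn (fun z ↦ max (poissonKernel 0 w z - c) 0 * u z)
      (closedBall 0 R \ ball 0 ρ) := by
  intro z hz
  rcases eq_or_ne z ζ with rfl | hzζ
  · have hzero : (fun z ↦ max (poissonKernel 0 w z - c) 0 * u z) =ᶠ[𝓝 z] fun _ ↦ 0 := by
      have hlt := (continuousAt_poissonKernel (w := w) (z := z)
        (by rintro rfl; exact hζ.false)).eventually_lt_const hc
      filter_upwards [hlt] with y hy
      rw [max_eq_right (by linarith), zero_mul]
    exact (continuousAt_const.congr hzero.symm).continuousWithinAt
  · have hzw : z ≠ w := by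
      rintro rfl
      exact hz.2 (by simpa using hwρ)
    have hcut : ContinuousAt (fun z ↦ max (poissonKernel 0 w z - c) 0) z :=
      ((continuousAt_poissonKernel hzw).sub continuousAt_const).max continuousAt_const
    refine hcut.continuousWithinAt.mul ((hu z ⟨hz.1, hzζ⟩).mono_of_mem_nhdsWithin ?_)
    filter_upwards [self_mem_nhdsWithin, mem_nhdsWithin_of_mem_nhds (isOpen_ne.mem_nhds hzζ)]
      with y hy hyζ using ⟨hy.1, hyζ⟩

theorem circleIntegrable_poissonKernel_cutoff_mul {c : ℝ} (hw : w ∈ ball (0 : ℂ) R)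
    (hu : CircleIntegrable u 0 R) :
    CircleIntegrable (fun z ↦ max (poissonKernel 0 w z - c) 0 * u z) 0 R := by
  have hP := (continuousOn_poissonKernel_sphere hw).comp_continuous (continuous_circleMap 0 R)
    (circleMap_mem_sphere' 0 R)
  exact IntervalIntegrable.continuousOn_mul hu
    ((hP.sub continuous_const).max continuous_const).continuousOn

theorem poissonIntegral_le_mul_circleAverage_add {c : ℝ} (hw : w ∈ ball (0 : ℂ) R)
    (hu0 : ∀ z ∈ sphere (0 : ℂ) R, 0 ≤ u z) (hu : CircleIntegrable u 0 R) :
    poissonIntegral R u w ≤ c * circleAverage u 0 R +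
      circleAverage (fun z ↦ max (poissonKernel 0 w z - c) 0 * u z) 0 R := by
  have hcut := circleIntegrable_poissonKernel_cutoff_mul (c := c) hw hu
  have hmul : CircleIntegrable (fun z ↦ c * u z) 0 R := hu.const_mul c
  rw [← circleAverage_const_mul, ← circleAverage_fun_add hmul hcut]
  refine circleAverage_mono (circleIntegrable_poissonKernel_mul hw hu) (hmul.add hcut)
    fun z hz ↦ ?_
  rw [sphere_abs_radius hw] at hz
  rw [Pi.mul_apply, ← add_mul]
  exact mul_le_mul_of_nonneg_right (by linarith [le_max_left (poissonKernel 0 w z - c) 0])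
    (hu0 z hz)

theorem circleAverage_poissonKernel_cutoff_mul_le {c : ℝ} (hc : 0 ≤ c) (hw : w ∈ ball (0 : ℂ) R)
    (hu0 : ∀ z ∈ sphere (0 : ℂ) R, 0 ≤ u z) (hu : CircleIntegrable u 0 R) :
    circleAverage (fun z ↦ max (poissonKernel 0 w z - c) 0 * u z) 0 R ≤ poissonIntegral R u w := by
  refine circleAverage_mono (circleIntegrable_poissonKernel_cutoff_mul hw hu)
    (circleIntegrable_poissonKernel_mul hw hu) fun z hz ↦ ?_
  rw [sphere_abs_radius hw] at hz
  exact mul_le_mul_of_nonneg_right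
    (max_le (by linarith) (poissonKernel_nonneg hw hz)) (hu0 z hz)

/-- The part of the Poisson integral over `|z| = r` on which the kernel is at most `c` contributes
at most `c * M`; the remaining part stays away from `ζ`, so it converges as `r → R`. -/
theorem le_poissonIntegral_add_mul {M c : ℝ} (hζ : ζ ∈ sphere (0 : ℂ) R)
    (hu : ContinuousOn u (closedBall 0 R \ {ζ})) (hu0 : ∀ z ∈ closedBall 0 R, 0 ≤ u z)
    (hint : CircleIntegrable u 0 R) (hw : w ∈ ball (0 : ℂ) R)
    (hP : ∀ r ∈ Ioo ‖w‖ R, u w ≤ poissonIntegral r u w)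
    (hM : ∀ᶠ r in 𝓝[<] R, circleAverage u 0 r ≤ M) (hc : poissonKernel 0 w ζ < c) :
    u w ≤ poissonIntegral R u w + c * M := by
  have hwR : ‖w‖ < R := by simpa using hw
  have hc0 : 0 ≤ c := (poissonKernel_nonneg hw hζ).trans hc.le
  obtain ⟨ρ, hwρ, hρR⟩ := exists_between hwR
  set f : ℂ → ℝ := fun z ↦ max (poissonKernel 0 w z - c) 0 * u z
  have hf : ContinuousOn f (closedBall 0 R \ ball 0 ρ) :=
    continuousOn_poissonKernel_cutoff_mul hwρ (by rwa [mem_sphere_zero_iff_norm.1 hζ]) hc hu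
  obtain ⟨B, hB⟩ :=
    ((isCompact_closedBall (0 : ℂ) R).diff isOpen_ball).exists_bound_of_continuousOn hf
  have hlim : Tendsto (circleAverage f 0) (𝓝[<] R) (𝓝 (circleAverage f 0 R)) :=
    tendsto_circleAverage_nhdsLT ((norm_nonneg w).trans hwρ.le) hρR countable_empty
      (empty_subset _) (by rwa [sdiff_empty]) (by rwa [sdiff_empty])
  have hle : ∀ᶠ r in 𝓝[<] R, u w ≤ c * M + circleAverage f 0 r := by
    filter_upwards [hM, Ioo_mem_nhdsLT hρR] with r hrM ⟨hρr, hrR⟩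
    have hwr : w ∈ ball (0 : ℂ) r := by simpa using hwρ.trans hρr
    have hsub : sphere (0 : ℂ) r ⊆ closedBall 0 R \ {ζ} := fun z hz ↦
      ⟨closedBall_subset_closedBall hrR.le (sphere_subset_closedBall hz), fun h ↦
        hrR.ne ((mem_sphere.1 hz).symm.trans (h ▸ mem_sphere.1 hζ))⟩
    have hur : CircleIntegrable u 0 r :=
      (hu.mono (by rwa [sphere_abs_radius hwr])).circleIntegrable'
    calc u w ≤ poissonIntegral r u w := hP r ⟨hwρ.trans hρr, hrR⟩
      _ ≤ c * circleAverage u 0 r + circleAverage f 0 r :=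
        poissonIntegral_le_mul_circleAverage_add hwr (fun z hz ↦ hu0 z (hsub hz).1) hur
      _ ≤ c * M + circleAverage f 0 r := by gcongr
  have hfR : circleAverage f 0 R ≤ poissonIntegral R u w :=
    circleAverage_poissonKernel_cutoff_mul_le hc0 hw
      (fun z hz ↦ hu0 z (sphere_subset_closedBall hz)) hint
  linarith [ge_of_tendsto (tendsto_const_nhds.add hlim) hle]

theorem le_poissonIntegral_add_mul_poissonKernel {M : ℝ} (hζ : ζ ∈ sphere (0 : ℂ) R)
    (hu : ContinuousOn u (closedBall 0 R \ {ζ})) (hu0 : ∀ z ∈ closedBall 0 R, 0 ≤ u z)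
    (hint : CircleIntegrable u 0 R) (hw : w ∈ ball (0 : ℂ) R)
    (hP : ∀ r ∈ Ioo ‖w‖ R, u w ≤ poissonIntegral r u w)
    (hM : ∀ᶠ r in 𝓝[<] R, circleAverage u 0 r ≤ M) :
    u w ≤ poissonIntegral R u w + poissonKernel 0 w ζ * M := by
  have hcont : Continuous fun c ↦ poissonIntegral R u w + c * M := by fun_prop
  refine ge_of_tendsto (hcont.continuousAt.tendsto.mono_left nhdsWithin_le_nhds)
    (eventually_mem_nhdsWithin.mono fun c hc ↦
      le_poissonIntegral_add_mul hζ hu hu0 hint hw hP hM (mem_Ioi.1 hc))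

end RadialLimit

end HardyDisc

namespace DeBranges

open Filter Topology Asymptotics

variable {f g : ℂ → ℂ}

/-- `f` has nonpositive exponential type along the positive imaginary axis; this is the form in
which nonpositivity of the mean type enters estimates. -/
def SubexpOnImag (f : ℂ → ℂ) : Prop :=
  ∀ ε > 0, (fun y : ℝ ↦ f (y * Complex.I)) =O[atTop] fun y ↦ Real.exp (ε * y)

theorem SubexpOnImag.of_isBigO (hg : SubexpOnImag g)
    (h : (fun y : ℝ ↦ f (y * Complex.I)) =O[atTop] fun y : ℝ ↦ g (y * Complex.I)) :
    SubexpOnImag f :=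
  fun ε hε ↦ h.trans (hg ε hε)

theorem SubexpOnImag.mul (hf : SubexpOnImag f) (hg : SubexpOnImag g) :
    SubexpOnImag fun z ↦ f z * g z := fun ε hε ↦
  ((hf _ (half_pos hε)).mul (hg _ (half_pos hε))).congr_right fun y ↦ by
    rw [← Real.exp_add]
    ring_nf

theorem subexpOnImag_add_I : SubexpOnImag fun z ↦ z + Complex.I := fun ε hε ↦ by
  have hlin : (fun y : ℝ ↦ (y : ℂ) * Complex.I + Complex.I) =O[atTop] fun y : ℝ ↦ y ^ 1 := by
    refine IsBigO.of_bound 2 ?_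
    filter_upwards [eventually_ge_atTop 1] with y hy
    have hnorm : ‖(y : ℂ) * Complex.I + Complex.I‖ = |y + 1| := by
      rw [← add_one_mul, norm_mul, Complex.norm_I, mul_one, ← Complex.ofReal_one,
        ← Complex.ofReal_add, Complex.norm_real, Real.norm_eq_abs]
    rw [hnorm, pow_one, Real.norm_of_nonneg (by linarith), abs_of_pos (by linarith)]
    linarith
  exact hlin.trans (isLittleO_pow_exp_pos_mul_atTop 1 hε).isBigO

end DeBranges

namespace HardyDisc

open Filter Topology MeasureTheory Metric Set Real InnerProductSpace Asymptotics
open DeBranges (SubexpOnImag)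

section PhragmenLindelof

theorem norm_cexp_neg_ofReal_mul (ε : ℝ) (z : ℂ) : ‖Complex.exp (-ε * z)‖ = rexp (-ε * z.re) := by
  simp [Complex.norm_exp]

theorem norm_mul_cexp_le_of_subexp {f : ℂ → ℂ} {C M ε : ℝ}
    (hf : DiffContOnCl ℂ f {z | 0 < z.re})
    (hexp : ∀ z : ℂ, 0 < z.re → ‖f z‖ ≤ C * rexp (M * ‖z‖))
    (hre : (fun x : ℝ ↦ f x) =O[atTop] fun x ↦ rexp (ε * x))
    (him : ∀ x : ℝ, ‖f (x * Complex.I)‖ ≤ C) (hε : 0 < ε) {z : ℂ} (hz : 0 ≤ z.re) :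
    ‖f z * Complex.exp (-ε * z)‖ ≤ C := by
  refine PhragmenLindelof.right_half_plane_of_bounded_on_real
    (f := fun z ↦ f z * Complex.exp (-ε * z)) ?_ ⟨1, one_lt_two, M, ?_⟩ ?_ (fun x ↦ ?_) hz
  · exact hf.smul (Differentiable.diffContOnCl (by fun_prop))
  · refine IsBigO.of_bound C (mem_inf_of_right fun z (hz : 0 < z.re) ↦ ?_)
    simp only [mem_ofPred_eq, norm_mul, norm_cexp_neg_ofReal_mul, rpow_one,
      norm_of_nonneg (exp_pos _).le]
    have hdecay : rexp (-ε * z.re) ≤ 1 := exp_le_one_iff.2 (by nlinarith)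
    exact (mul_le_of_le_one_right (norm_nonneg _) hdecay).trans (hexp z hz)
  · have hbdd : (fun x : ℝ ↦ f x * Complex.exp (-ε * x)) =O[atTop] fun _ ↦ (1 : ℝ) := by
      refine (hre.mul (IsBigO.of_norm_left (g := fun x : ℝ ↦ rexp (-ε * x)) ?_)).congr_right ?_
      · simpa only [norm_cexp_neg_ofReal_mul, Complex.ofReal_re] using isBigO_refl _ _
      · intro x
        simp [← exp_add]
    exact hbdd.isBoundedUnder_le
  · rw [norm_mul, norm_cexp_neg_ofReal_mul]
    simpa using him x

theorem norm_le_of_subexp {f : ℂ → ℂ} {C M : ℝ} (hf : DiffContOnCl ℂ f {z | 0 < z.re})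
    (hexp : ∀ z : ℂ, 0 < z.re → ‖f z‖ ≤ C * rexp (M * ‖z‖))
    (hre : ∀ ε > 0, (fun x : ℝ ↦ f x) =O[atTop] fun x ↦ rexp (ε * x))
    (him : ∀ x : ℝ, ‖f (x * Complex.I)‖ ≤ C) {z : ℂ} (hz : 0 ≤ z.re) : ‖f z‖ ≤ C := by
  have hcont : Continuous fun ε : ℝ ↦ ‖f z * Complex.exp (-ε * z)‖ := by fun_prop
  have hlim : Tendsto (fun ε : ℝ ↦ ‖f z * Complex.exp (-ε * z)‖) (𝓝[>] 0) (𝓝 ‖f z‖) :=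
    (hcont.tendsto' _ _ (by simp)).mono_left nhdsWithin_le_nhds
  exact le_of_tendsto hlim (eventually_mem_nhdsWithin.mono fun ε hε ↦
    norm_mul_cexp_le_of_subexp hf hexp (hre ε hε) him hε hz)

theorem norm_le_exp_mul_of_subexpOnImag {f : ℂ → ℂ} {M δ : ℝ} (hM : 0 ≤ M)
    (hf : DifferentiableOn ℂ f {z | 0 < z.im})
    (hexp : ∀ z : ℂ, 0 < z.im → ‖f z‖ ≤ rexp (M * z.im)) (himag : SubexpOnImag f) (hδ : 0 < δ)
    {z : ℂ} (hz : δ ≤ z.im) : ‖f z‖ ≤ rexp (M * δ) := by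
  set φ : ℂ → ℂ := fun ζ ↦ Complex.I * (ζ + δ)
  have hφim (ζ : ℂ) : (φ ζ).im = ζ.re + δ := by simp [φ]
  have hφ : f z = f (φ (-Complex.I * z - δ)) := by
    congr 1
    linear_combination z * Complex.I_mul_I
  rw [hφ]
  refine norm_le_of_subexp (f := fun ζ ↦ f (φ ζ)) (M := M) (DifferentiableOn.diffContOnCl ?_)
    (fun ζ hζ ↦ ?_) (fun ε hε ↦ ?_) (fun x ↦ ?_) (by simpa using hz)
  · rw [Complex.closure_setOfPred_lt_re]
    refine hf.comp (by fun_prop) fun ζ (hζ : 0 ≤ ζ.re) ↦ ?_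
    simp only [mem_ofPred_eq, hφim]
    positivity
  · refine (hexp _ (by rw [hφim]; positivity)).trans ?_
    rw [← exp_add, hφim, exp_le_exp, add_comm, mul_add]
    gcongr
    exact (le_abs_self _).trans (Complex.abs_re_le_norm ζ)
  · have hshift := (himag ε hε).comp_tendsto (tendsto_atTop_add_const_right _ δ tendsto_id)
    have hexp_shift : (fun x : ℝ ↦ rexp (ε * (x + δ))) =O[atTop] fun x ↦ rexp (ε * x) := by
      simp only [mul_add, exp_add, mul_comm (rexp (ε * _)) (rexp (ε * δ))]
      exact isBigO_const_mul_self _ _ _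
    refine (hshift.trans hexp_shift).congr_left fun x ↦ ?_
    simp [φ, mul_comm]
  · have hx := hexp (φ (x * Complex.I)) (by rw [hφim]; simpa using hδ)
    rw [hφim] at hx
    simpa using hx

theorem norm_le_one_of_subexpOnImag {f : ℂ → ℂ} {M : ℝ} (hM : 0 ≤ M)
    (hf : DifferentiableOn ℂ f {z | 0 < z.im})
    (hexp : ∀ z : ℂ, 0 < z.im → ‖f z‖ ≤ rexp (M * z.im)) (himag : SubexpOnImag f)
    {z : ℂ} (hz : 0 < z.im) : ‖f z‖ ≤ 1 := by
  have hcont : Continuous fun δ : ℝ ↦ rexp (M * δ) := by fun_prop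
  have hlim : Tendsto (fun δ : ℝ ↦ rexp (M * δ)) (𝓝[>] 0) (𝓝 1) :=
    (hcont.tendsto' 0 1 (by simp)).mono_left nhdsWithin_le_nhds
  refine ge_of_tendsto hlim ?_
  filter_upwards [Ioc_mem_nhdsGT hz] with δ hδ
  exact norm_le_exp_mul_of_subexpOnImag hM hf hexp himag hδ.1 hδ.2

end PhragmenLindelof

section Cayley

variable {z w : ℂ}

/-- The Cayley transform of the upper half-plane onto the unit disc. -/
noncomputable def cayley (z : ℂ) : ℂ := (z - Complex.I) / (z + Complex.I)

/-- The inverse Cayley transform, from the unit disc onto the upper half-plane; it sends the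
boundary point `1` to infinity. -/
noncomputable def cayleyInv (w : ℂ) : ℂ := Complex.I * (1 + w) / (1 - w)

theorem add_I_ne_zero (hz : 0 ≤ z.im) : z + Complex.I ≠ 0 := fun h ↦ by
  have him := congrArg Complex.im h
  simp only [Complex.add_im, Complex.I_im, Complex.zero_im] at him
  linarith

theorem one_sub_ne_zero (hw : w ∈ ball (0 : ℂ) 1) : 1 - w ≠ 0 := fun h ↦ by
  rw [sub_eq_zero] at h
  simp [← h] at hw

theorem one_sub_norm_cayley_sq (hz : 0 ≤ z.im) :
    1 - ‖cayley z‖ ^ 2 = 4 * z.im / ‖z + Complex.I‖ ^ 2 := by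
  have h : Complex.normSq (z + Complex.I) ≠ 0 := by simpa using add_I_ne_zero hz
  rw [cayley, norm_div, div_pow, ← Complex.normSq_eq_norm_sq, ← Complex.normSq_eq_norm_sq]
  field_simp
  simp [Complex.normSq_apply]
  ring

theorem one_sub_cayley (hz : 0 ≤ z.im) : 1 - cayley z = 2 * Complex.I / (z + Complex.I) := by
  have := add_I_ne_zero hz
  rw [cayley]
  field_simp
  ring

theorem cayley_mem_ball (hz : 0 < z.im) : cayley z ∈ ball (0 : ℂ) 1 := by
  have hI : 0 < ‖z + Complex.I‖ := norm_pos_iff.2 (add_I_ne_zero hz.le)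
  have hpos : 0 < 1 - ‖cayley z‖ ^ 2 := by
    rw [one_sub_norm_cayley_sq hz.le]
    positivity
  rw [mem_ball_zero_iff]
  nlinarith [norm_nonneg (cayley z)]

theorem poissonKernel_cayley_one (hz : 0 < z.im) : poissonKernel 0 (cayley z) 1 = z.im := by
  have hI : ‖z + Complex.I‖ ≠ 0 := norm_ne_zero_iff.2 (add_I_ne_zero hz.le)
  rw [poissonKernel_def]
  simp only [sub_zero, norm_one, one_pow]
  rw [one_sub_norm_cayley_sq hz.le, one_sub_cayley hz.le, norm_div, norm_mul, Complex.norm_I,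
    Complex.norm_ofNat]
  field_simp
  ring

theorem differentiableOn_cayley : DifferentiableOn ℂ cayley {z | 0 < z.im} := fun z hz ↦ by
  have := add_I_ne_zero (le_of_lt hz)
  unfold cayley
  fun_prop (disch := assumption)

theorem mapsTo_cayley : MapsTo cayley {z | 0 < z.im} (ball 0 1) := fun _ hz ↦ cayley_mem_ball hz

theorem im_cayleyInv (w : ℂ) : (cayleyInv w).im = (1 - ‖w‖ ^ 2) / ‖1 - w‖ ^ 2 := by
  rw [cayleyInv, mul_div_assoc, Complex.I_mul_im, Complex.div_re, ← Complex.normSq_eq_norm_sq,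
    ← Complex.normSq_eq_norm_sq, ← add_div]
  congr 1
  simp [Complex.normSq_apply]
  ring

theorem im_cayleyInv_nonneg (hw : w ∈ closedBall (0 : ℂ) 1) : 0 ≤ (cayleyInv w).im := by
  have hw1 : ‖w‖ ≤ 1 := by simpa using hw
  rw [im_cayleyInv]
  exact div_nonneg (by nlinarith [norm_nonneg w]) (by positivity)

theorem im_cayleyInv_pos (hw : w ∈ ball (0 : ℂ) 1) : 0 < (cayleyInv w).im := by
  have hw1 : ‖w‖ < 1 := by simpa using hw
  have hpos : 0 < ‖1 - w‖ := norm_pos_iff.2 (one_sub_ne_zero hw)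
  rw [im_cayleyInv]
  exact div_pos (by nlinarith [norm_nonneg w]) (by positivity)

theorem cayley_cayleyInv (hw : w ∈ ball (0 : ℂ) 1) : cayley (cayleyInv w) = w := by
  have h1 := one_sub_ne_zero hw
  rw [cayley, div_eq_iff (add_I_ne_zero (im_cayleyInv_pos hw).le), cayleyInv]
  field_simp
  ring

theorem cayleyInv_cayley (hz : 0 < z.im) : cayleyInv (cayley z) = z := by
  have h := add_I_ne_zero hz.le
  rw [cayleyInv, div_eq_iff (one_sub_ne_zero (cayley_mem_ball hz)), one_sub_cayley hz.le, cayley]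
  field_simp
  ring

theorem continuousOn_cayleyInv : ContinuousOn cayleyInv {1}ᶜ := fun w hw ↦ by
  have h : 1 - w ≠ 0 := sub_ne_zero.2 (Ne.symm hw)
  unfold cayleyInv
  apply ContinuousAt.continuousWithinAt
  fun_prop (disch := assumption)

theorem differentiableOn_cayleyInv : DifferentiableOn ℂ cayleyInv (ball 0 1) := fun w hw ↦ by
  have h := one_sub_ne_zero hw
  unfold cayleyInv
  fun_prop (disch := assumption)

end Cayley

section PoissonMajorant

variable {k : ℂ → ℂ} {R : ℝ}

theorem circleIntegrable_posLog_norm (hk : CircleIntegrable k 0 R) :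
    CircleIntegrable (fun z ↦ log⁺ ‖k z‖) 0 R := by
  refine IntervalIntegrable.mono_fun (IntervalIntegrable.norm hk) ?_ (.of_forall fun θ ↦ ?_)
  · exact continuous_posLog.comp_aestronglyMeasurable
      (intervalIntegrable_iff.1 hk).aestronglyMeasurable.norm
  · simp only [norm_of_nonneg posLog_nonneg, norm_norm]
    exact max_le (norm_nonneg _) (log_le_self (norm_nonneg _))

theorem circleIntegrable_max_one_norm (hk : CircleIntegrable k 0 R) :
    CircleIntegrable (fun z ↦ max 1 ‖k z‖) 0 R :=
  ⟨(integrable_const (1 : ℝ)).sup hk.1.norm, (integrable_const (1 : ℝ)).sup hk.2.norm⟩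

theorem exp_posLog {x : ℝ} (hx : 0 ≤ x) : rexp (log⁺ x) = max 1 x := by
  rw [posLog_eq_log_max_one hx, exp_log (by positivity)]

theorem exists_differentiableOn_re_eq_poissonIntegral {u : ℂ → ℝ} (hu : CircleIntegrable u 0 R) :
    ∃ L : ℂ → ℂ, DifferentiableOn ℂ L (ball 0 R) ∧
      ∀ w ∈ ball 0 R, (L w).re = poissonIntegral R u w := by
  refine ⟨fun w ↦ circleAverage (fun ζ ↦ herglotzRieszKernel 0 w ζ • ((u ζ : ℝ) : ℂ)) 0 R,
    differentiableOn_circleAverage_herglotzRieszKernel_smul ⟨hu.1.ofReal, hu.2.ofReal⟩,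
    fun w hw ↦ ?_⟩
  rw [poissonIntegral, poissonKernel_eq_re_herglotzRieszKernel]
  exact re_circleAverage_herglotzRieszKernel_smul hu hw

theorem posLog_norm_le_poissonIntegral_add {M : ℝ} {w : ℂ}
    (hk : ContinuousOn k (closedBall 0 1 \ {1})) (hkd : DifferentiableOn ℂ k (ball 0 1))
    (hI : CircleIntegrable k 0 1)
    (hM : ∀ᶠ r in 𝓝[<] (1 : ℝ), circleAverage (fun z ↦ log⁺ ‖k z‖) 0 r ≤ M)
    (hw : w ∈ ball (0 : ℂ) 1) :
    log⁺ ‖k w‖ ≤ poissonIntegral 1 (fun z ↦ log⁺ ‖k z‖) w + poissonKernel 0 w 1 * M :=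
  le_poissonIntegral_add_mul_poissonKernel (u := fun z ↦ log⁺ ‖k z‖) (by simp)
    (continuous_posLog.comp_continuousOn hk.norm) (fun _ _ ↦ posLog_nonneg)
    (circleIntegrable_posLog_norm hI) hw
    (fun r hr ↦ posLog_norm_le_poissonIntegral (by simpa using hr.1)
      ((hkd.analyticOnNhd isOpen_ball).mono (closedBall_subset_ball hr.2))) hM

/-- Dividing `k` by the outer function with boundary modulus `max 1 |k|` leaves a function bounded
by `exp (M * Im z)` in the half-plane, and the Phragmén–Lindelöf principle removes the factor. -/
theorem norm_le_exp_poissonIntegral {M : ℝ} {w : ℂ}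
    (hk : ContinuousOn k (closedBall 0 1 \ {1})) (hkd : DifferentiableOn ℂ k (ball 0 1))
    (hI : CircleIntegrable k 0 1)
    (hM : ∀ᶠ r in 𝓝[<] (1 : ℝ), circleAverage (fun z ↦ log⁺ ‖k z‖) 0 r ≤ M)
    (himag : SubexpOnImag (k ∘ cayley)) (hw : w ∈ ball (0 : ℂ) 1) :
    ‖k w‖ ≤ rexp (poissonIntegral 1 (fun z ↦ log⁺ ‖k z‖) w) := by
  obtain ⟨L, hL, hLre⟩ :=
    exists_differentiableOn_re_eq_poissonIntegral (circleIntegrable_posLog_norm hI)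
  have hM0 : 0 ≤ M := by
    obtain ⟨r, hr⟩ := hM.exists
    exact (circleAverage_nonneg_of_nonneg fun _ _ ↦ posLog_nonneg).trans hr
  set β : ℂ → ℂ := fun w ↦ k w * Complex.exp (-L w)
  have hβ {w : ℂ} (hw : w ∈ ball (0 : ℂ) 1) :
      ‖β w‖ = ‖k w‖ / rexp (poissonIntegral 1 (fun z ↦ log⁺ ‖k z‖) w) := by
    rw [norm_mul, Complex.norm_exp, Complex.neg_re, hLre w hw, exp_neg, div_eq_mul_inv]
  have hone : ‖β (cayley (cayleyInv w))‖ ≤ 1 := by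
    refine norm_le_one_of_subexpOnImag (f := β ∘ cayley) hM0
      ((hkd.mul hL.neg.cexp).comp differentiableOn_cayley mapsTo_cayley) (fun z hz ↦ ?_)
      (fun ε hε ↦ ?_) (im_cayleyInv_pos hw)
    · have hc := cayley_mem_ball hz
      have hlog := posLog_norm_le_poissonIntegral_add hk hkd hI hM hc
      rw [poissonKernel_cayley_one hz] at hlog
      rw [Function.comp_apply, hβ hc, div_le_iff₀ (exp_pos _), ← exp_add]
      calc ‖k (cayley z)‖ ≤ rexp (log⁺ ‖k (cayley z)‖) := by
            rw [exp_posLog (norm_nonneg _)]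
            exact le_max_right _ _
        _ ≤ _ := by
          rw [exp_le_exp]
          linarith
    · refine IsBigO.trans (IsBigO.of_bound 1 ?_) (himag ε hε)
      filter_upwards [eventually_gt_atTop 0] with y hy
      have hc := cayley_mem_ball (z := y * Complex.I) (by simpa using hy)
      rw [Function.comp_apply, hβ hc, one_mul]
      exact div_le_self (norm_nonneg _)
        (one_le_exp (poissonIntegral_nonneg hc fun _ _ ↦ posLog_nonneg))
  rwa [cayley_cayleyInv hw, hβ hw, div_le_one (exp_pos _)] at hone

theorem norm_le_poissonIntegral_max_one {M : ℝ} {w : ℂ}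
    (hk : ContinuousOn k (closedBall 0 1 \ {1})) (hkd : DifferentiableOn ℂ k (ball 0 1))
    (hI : CircleIntegrable k 0 1)
    (hM : ∀ᶠ r in 𝓝[<] (1 : ℝ), circleAverage (fun z ↦ log⁺ ‖k z‖) 0 r ≤ M)
    (himag : SubexpOnImag (k ∘ cayley)) (hw : w ∈ ball (0 : ℂ) 1) :
    ‖k w‖ ≤ poissonIntegral 1 (fun z ↦ max 1 ‖k z‖) w := by
  have hexp : (fun z ↦ rexp (log⁺ ‖k z‖)) = fun z ↦ max 1 ‖k z‖ :=
    funext fun z ↦ exp_posLog (norm_nonneg _)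
  refine (norm_le_exp_poissonIntegral hk hkd hI hM himag hw).trans ?_
  rw [← hexp]
  exact exp_poissonIntegral_le hw (circleIntegrable_posLog_norm hI)
    (hexp ▸ circleIntegrable_max_one_norm hI)

end PoissonMajorant

section Truncation

variable {N : ℝ}

/-- Radial truncation of a complex number to modulus at most `N`. -/
noncomputable def truncate (N : ℝ) (x : ℂ) : ℂ := (N / max N ‖x‖) • x

theorem continuous_truncate (hN : 0 < N) : Continuous (truncate N) := by
  have hmax (x : ℂ) : max N ‖x‖ ≠ 0 := (lt_max_of_lt_left hN).ne'
  unfold truncate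
  fun_prop (disch := assumption)

theorem norm_truncate_le (hN : 0 < N) (x : ℂ) : ‖truncate N x‖ ≤ N := by
  rw [truncate, norm_smul, norm_of_nonneg (by positivity), div_mul_eq_mul_div,
    div_le_iff₀ (lt_max_of_lt_left hN)]
  gcongr
  exact le_max_right _ _

theorem norm_sub_truncate (hN : 0 < N) (x : ℂ) : ‖x - truncate N x‖ = max (‖x‖ - N) 0 := by
  rcases le_total N ‖x‖ with hNx | hxN
  · have hx : 0 < ‖x‖ := hN.trans_le hNx
    have hcoef : 0 ≤ 1 - N / ‖x‖ := sub_nonneg.2 ((div_le_one hx).2 hNx)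
    rw [truncate, max_eq_right hNx, max_eq_left (sub_nonneg.2 hNx)]
    nth_rw 1 [← one_smul ℝ x]
    rw [← sub_smul, norm_smul, norm_of_nonneg hcoef]
    field_simp
  · rw [truncate, max_eq_left hxN, max_eq_right (sub_nonpos.2 hxN), div_self hN.ne', one_smul,
      sub_self, norm_zero]

end Truncation

section MeanValue

variable {R r N : ℝ} {k : ℂ → ℂ} {v : ℂ → ℝ} {S : Set ℂ}

theorem norm_circleAverage_le (f : ℂ → ℂ) (c : ℂ) (R : ℝ) :
    ‖circleAverage f c R‖ ≤ circleAverage (fun z ↦ ‖f z‖) c R := by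
  rw [circleAverage_def, circleAverage_def, norm_smul, smul_eq_mul, norm_of_nonneg (by positivity)]
  gcongr
  exact intervalIntegral.norm_integral_le_integral_norm two_pi_pos.le

theorem harmonicOnNhd_poissonIntegral (hv : CircleIntegrable v 0 R) :
    HarmonicOnNhd (poissonIntegral R v) (ball 0 R) := fun w hw ↦ by
  obtain ⟨L, hL, hLre⟩ := exists_differentiableOn_re_eq_poissonIntegral hv
  refine (harmonicAt_congr_nhds ?_).1 (hL.analyticAt (isOpen_ball.mem_nhds hw)).harmonicAt_re
  filter_upwards [isOpen_ball.mem_nhds hw] with z hz using hLre z hz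

theorem poissonIntegral_zero (hR : 0 < R) : poissonIntegral R v 0 = circleAverage v 0 R := by
  refine circleAverage_congr_sphere fun z hz ↦ ?_
  rw [abs_of_pos hR, mem_sphere_zero_iff_norm] at hz
  simp [poissonKernel_def, hz, hR.ne']

theorem circleAverage_poissonIntegral (hv : CircleIntegrable v 0 R) (hr : |r| < R) :
    circleAverage (poissonIntegral R v) 0 r = circleAverage v 0 R := by
  rw [((harmonicOnNhd_poissonIntegral hv).mono (closedBall_subset_ball hr)).circleAverage_eq,
    poissonIntegral_zero ((abs_nonneg r).trans_lt hr)]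

theorem circleIntegrable_poissonIntegral (hv : CircleIntegrable v 0 R) (hr : |r| < R) :
    CircleIntegrable (poissonIntegral R v) 0 r :=
  ContinuousOn.circleIntegrable' fun w hw ↦
    (harmonicOnNhd_poissonIntegral hv w
      (closedBall_subset_ball hr (sphere_subset_closedBall hw))).1.continuousAt.continuousWithinAt

theorem circleIntegrable_max_sub (hv : CircleIntegrable v 0 R) (N : ℝ) :
    CircleIntegrable (fun z ↦ max (v z - N) 0) 0 R :=
  ⟨(hv.1.sub (integrable_const N)).pos_part, (hv.2.sub (integrable_const N)).pos_part⟩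

theorem max_sub_le_poissonIntegral {w : ℂ} {x : ℝ} (hw : w ∈ ball (0 : ℂ) R)
    (hv : CircleIntegrable v 0 R) (hx : x ≤ poissonIntegral R v w) :
    max (x - N) 0 ≤ poissonIntegral R (fun z ↦ max (v z - N) 0) w := by
  have hexcess := circleIntegrable_max_sub hv N
  refine max_le ?_ (poissonIntegral_nonneg hw fun _ _ ↦ le_max_right _ _)
  rw [sub_le_iff_le_add']
  calc x ≤ poissonIntegral R v w := hx
    _ ≤ poissonIntegral R ((fun _ ↦ N) + fun z ↦ max (v z - N) 0) w :=
      poissonIntegral_mono hw hv ((circleIntegrable_const N 0 R).add hexcess) fun z _ ↦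
        sub_le_iff_le_add'.1 (le_max_left _ _)
    _ = N + poissonIntegral R (fun z ↦ max (v z - N) 0) w := by
      rw [poissonIntegral_add hw (circleIntegrable_const N 0 R) hexcess, poissonIntegral_const hw]

theorem tendsto_circleAverage_max_sub (hv : CircleIntegrable v 0 R) :
    Tendsto (fun N ↦ circleAverage (fun z ↦ max (v z - N) 0) 0 R) atTop (𝓝 0) := by
  suffices hlim : Tendsto (fun N ↦ circleAverage (fun z ↦ max (v z - N) 0) 0 R) atTop
      (𝓝 (circleAverage (fun _ ↦ 0) 0 R)) by
    rwa [circleAverage_const] at hlim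
  refine Tendsto.const_smul (intervalIntegral.tendsto_integral_filter_of_dominated_convergence
    (fun θ ↦ |v (circleMap 0 R θ)|) ?_ ?_ (IntervalIntegrable.abs hv) ?_) _
  · exact .of_forall fun N ↦
      (intervalIntegrable_iff.1 (circleIntegrable_max_sub hv N)).aestronglyMeasurable
  · filter_upwards [eventually_ge_atTop 0] with N hN
    refine .of_forall fun θ _ ↦ ?_
    rw [norm_of_nonneg (le_max_right _ _)]
    exact max_le ((sub_le_self _ hN).trans (le_abs_self _)) (abs_nonneg _)
  · refine .of_forall fun θ _ ↦ tendsto_const_nhds.congr' ?_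
    filter_upwards [eventually_ge_atTop (v (circleMap 0 R θ))] with N hN
    rw [max_eq_right (sub_nonpos.2 hN)]

theorem circleIntegrable_truncate (hN : 0 < N) (hk : CircleIntegrable k 0 R) :
    CircleIntegrable (fun z ↦ truncate N (k z)) 0 R := by
  refine (circleIntegrable_const N 0 R).mono_fun ?_ (.of_forall fun θ ↦ ?_)
  · exact (continuous_truncate hN).comp_aestronglyMeasurable
      (intervalIntegrable_iff.1 hk).aestronglyMeasurable
  · exact (norm_truncate_le hN _).trans (le_abs_self N)

theorem norm_circleAverage_sub_truncate_le (hN : 0 < N) (hk : CircleIntegrable k 0 R) :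
    ‖circleAverage k 0 R - circleAverage (fun z ↦ truncate N (k z)) 0 R‖ ≤
      circleAverage (fun z ↦ max (‖k z‖ - N) 0) 0 R := by
  rw [← circleAverage_fun_sub hk (circleIntegrable_truncate hN hk)]
  refine (norm_circleAverage_le _ _ _).trans_eq ?_
  simp only [norm_sub_truncate hN]

theorem norm_sub_circleAverage_truncate_le (hkd : DifferentiableOn ℂ k (ball 0 R))
    (hv : CircleIntegrable v 0 R) (hkv : ∀ w ∈ ball 0 R, ‖k w‖ ≤ poissonIntegral R v w)
    (hN : 0 < N) (hr : |r| < R) :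
    ‖k 0 - circleAverage (fun z ↦ truncate N (k z)) 0 r‖ ≤
      circleAverage (fun z ↦ max (v z - N) 0) 0 R := by
  have hball : closedBall (0 : ℂ) |r| ⊆ ball 0 R := closedBall_subset_ball hr
  have hkr : CircleIntegrable k 0 r :=
    (hkd.continuousOn.mono (sphere_subset_closedBall.trans hball)).circleIntegrable'
  have hmean : circleAverage k 0 r = k 0 :=
    DiffContOnCl.circleAverage
      (hkd.mono (closure_ball_subset_closedBall.trans hball)).diffContOnCl
  rw [← hmean, ← circleAverage_poissonIntegral (circleIntegrable_max_sub hv N) hr]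
  refine (norm_circleAverage_sub_truncate_le hN hkr).trans (circleAverage_mono
    (circleIntegrable_max_sub (v := fun z ↦ ‖k z‖) hkr.norm N)
    (circleIntegrable_poissonIntegral (circleIntegrable_max_sub hv N) hr) fun w hw ↦ ?_)
  have hwR := hball (sphere_subset_closedBall hw)
  exact max_sub_le_poissonIntegral hwR hv (hkv w hwR)

/-- The bound by a Poisson integral makes the means over smaller circles uniformly integrable:
truncating `k` at height `N` changes every mean by at most the mean of `(v - N)⁺`. -/
theorem circleAverage_eq_of_norm_le_poissonIntegral (hR : 0 < R) (hS : S.Countable)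
    (hSR : S ⊆ sphere 0 R) (hk : ContinuousOn k (closedBall 0 R \ S))
    (hkd : DifferentiableOn ℂ k (ball 0 R)) (hkI : CircleIntegrable k 0 R)
    (hv : CircleIntegrable v 0 R) (hkv : ∀ w ∈ ball 0 R, ‖k w‖ ≤ poissonIntegral R v w)
    (hkv' : ∀ z ∈ sphere 0 R, ‖k z‖ ≤ v z) : circleAverage k 0 R = k 0 := by
  set a : ℝ → ℝ := fun N ↦ circleAverage (fun z ↦ max (v z - N) 0) 0 R
  have hbound (N : ℝ) (hN : 0 < N) : ‖circleAverage k 0 R - k 0‖ ≤ a N + a N := by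
    set f : ℂ → ℂ := fun z ↦ truncate N (k z)
    have hlim : Tendsto (circleAverage f 0) (𝓝[<] R) (𝓝 (circleAverage f 0 R)) :=
      tendsto_circleAverage_nhdsLT le_rfl hR hS hSR
        (((continuous_truncate hN).comp_continuousOn hk).mono
          (sdiff_subset_sdiff_left sdiff_subset)) fun z _ ↦ norm_truncate_le hN _
    have hinside : ‖k 0 - circleAverage f 0 R‖ ≤ a N := by
      refine le_of_tendsto (tendsto_const_nhds.sub hlim).norm ?_
      filter_upwards [Ioo_mem_nhdsLT hR] with r hr
      exact norm_sub_circleAverage_truncate_le hkd hv hkv hN (by rw [abs_of_pos hr.1]; exact hr.2)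
    have hboundary : ‖circleAverage k 0 R - circleAverage f 0 R‖ ≤ a N := by
      refine (norm_circleAverage_sub_truncate_le hN hkI).trans (circleAverage_mono
        (circleIntegrable_max_sub (v := fun z ↦ ‖k z‖) hkI.norm N)
        (circleIntegrable_max_sub hv N) fun z hz ↦ ?_)
      rw [abs_of_pos hR] at hz
      gcongr
      exact hkv' z hz
    calc ‖circleAverage k 0 R - k 0‖
        = ‖(circleAverage k 0 R - circleAverage f 0 R) - (k 0 - circleAverage f 0 R)‖ := by
          rw [sub_sub_sub_cancel_right]
      _ ≤ a N + a N := norm_sub_le_of_le hboundary hinside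
  have ha : Tendsto a atTop (𝓝 0) := tendsto_circleAverage_max_sub hv
  have hzero := ge_of_tendsto (ha.add ha) ((eventually_gt_atTop 0).mono hbound)
  rw [add_zero, norm_le_zero_iff, sub_eq_zero] at hzero
  exact hzero

end MeanValue

section AngleTan

variable {θ : ℝ}

/-- The boundary values of the inverse Cayley transform, as a function of the angle. -/
noncomputable def angleTan (θ : ℝ) : ℝ := tan ((θ - π) / 2)

theorem half_angle_mem (hθ : θ ∈ Ioo 0 (2 * π)) : (θ - π) / 2 ∈ Ioo (-(π / 2)) (π / 2) :=
  ⟨by linarith [hθ.1], by linarith [hθ.2]⟩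

theorem cos_half_angle_pos (hθ : θ ∈ Ioo 0 (2 * π)) : 0 < cos ((θ - π) / 2) :=
  cos_pos_of_mem_Ioo (half_angle_mem hθ)

theorem hasDerivAt_angleTan (hθ : θ ∈ Ioo 0 (2 * π)) :
    HasDerivAt angleTan (1 / (2 * cos ((θ - π) / 2) ^ 2)) θ := by
  have hhalf : HasDerivAt (fun θ : ℝ ↦ (θ - π) / 2) (1 / 2) θ :=
    ((hasDerivAt_id θ).sub_const π).div_const 2
  refine ((hasDerivAt_tan (cos_half_angle_pos hθ).ne').comp θ hhalf).congr_deriv ?_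
  rw [one_div_mul_one_div, mul_comm]

theorem injOn_angleTan : InjOn angleTan (Ioo 0 (2 * π)) := fun x hx y hy hxy ↦ by
  linarith [injOn_tan (half_angle_mem hx) (half_angle_mem hy) hxy]

theorem image_angleTan : angleTan '' Ioo 0 (2 * π) = univ := eq_univ_of_forall fun t ↦ by
  refine ⟨2 * arctan t + π, ⟨?_, ?_⟩, ?_⟩
  · linarith [neg_pi_div_two_lt_arctan t]
  · linarith [arctan_lt_pi_div_two t]
  · rw [angleTan, show (2 * arctan t + π - π) / 2 = arctan t by ring, tan_arctan]

theorem circleMap_eq_neg_sq (θ : ℝ) : circleMap 0 1 θ =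
    -((cos ((θ - π) / 2) : ℂ) + (sin ((θ - π) / 2) : ℂ) * Complex.I) ^ 2 := by
  have harg : (θ : ℂ) * Complex.I =
      (2 : ℕ) * ((((θ - π) / 2 : ℝ) : ℂ) * Complex.I) + π * Complex.I := by
    push_cast
    ring
  rw [circleMap_zero, Complex.ofReal_one, one_mul, harg, Complex.exp_add, Complex.exp_pi_mul_I,
    Complex.exp_nat_mul, Complex.exp_mul_I, Complex.ofReal_cos, Complex.ofReal_sin]
  ring

theorem cos_add_sin_mul_I_ne_zero (x : ℝ) : (cos x : ℂ) + (sin x : ℂ) * Complex.I ≠ 0 := by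
  rw [Complex.ofReal_cos, Complex.ofReal_sin, ← Complex.exp_mul_I]
  exact Complex.exp_ne_zero _

theorem ofReal_cos_sq_add_ofReal_sin_sq (x : ℝ) : (cos x : ℂ) ^ 2 + (sin x : ℂ) ^ 2 = 1 := by
  exact_mod_cast cos_sq_add_sin_sq x

theorem one_sub_circleMap (θ : ℝ) : 1 - circleMap 0 1 θ =
    2 * (cos ((θ - π) / 2) : ℂ) *
      ((cos ((θ - π) / 2) : ℂ) + (sin ((θ - π) / 2) : ℂ) * Complex.I) := by
  rw [circleMap_eq_neg_sq]
  linear_combination (-1 : ℂ) * ofReal_cos_sq_add_ofReal_sin_sq ((θ - π) / 2)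
    + (sin ((θ - π) / 2) : ℂ) ^ 2 * Complex.I_sq

theorem cayleyInv_circleMap (hθ : θ ∈ Ioo 0 (2 * π)) :
    cayleyInv (circleMap 0 1 θ) = angleTan θ := by
  have hcos : (cos ((θ - π) / 2) : ℂ) ≠ 0 := by exact_mod_cast (cos_half_angle_pos hθ).ne'
  have hexp := cos_add_sin_mul_I_ne_zero ((θ - π) / 2)
  have hone := ofReal_cos_sq_add_ofReal_sin_sq ((θ - π) / 2)
  rw [cayleyInv, one_sub_circleMap, angleTan, tan_eq_sin_div_cos, Complex.ofReal_div,
    div_eq_div_iff (mul_ne_zero (mul_ne_zero two_ne_zero hcos) hexp) hcos, circleMap_eq_neg_sq]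
  set c := (cos ((θ - π) / 2) : ℂ)
  set s := (sin ((θ - π) / 2) : ℂ)
  linear_combination (-Complex.I * c) * hone +
    (-2 * c ^ 2 * s - Complex.I * s ^ 2 * c) * Complex.I_sq

end AngleTan

section CayleyPullback

variable {g : ℂ → ℂ}

/-- The transport of `g` from the upper half-plane to the disc for which
`w * cayleyPullback g w * dθ` is a constant multiple of `g t * dt` on the boundary. -/
noncomputable def cayleyPullback (g : ℂ → ℂ) (w : ℂ) : ℂ := g (cayleyInv w) / (1 - w) ^ 2

theorem continuousOn_cayleyPullback (hg : ContinuousOn g {z | 0 ≤ z.im}) :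
    ContinuousOn (cayleyPullback g) (closedBall 0 1 \ {1}) :=
  ContinuousOn.div
    (hg.comp (continuousOn_cayleyInv.mono fun _ hw ↦ hw.2) fun _ hw ↦ im_cayleyInv_nonneg hw.1)
    (by fun_prop) fun _ hw ↦ pow_ne_zero _ (sub_ne_zero.2 (Ne.symm hw.2))

theorem differentiableOn_cayleyPullback (hg : DifferentiableOn ℂ g {z | 0 < z.im}) :
    DifferentiableOn ℂ (cayleyPullback g) (ball 0 1) :=
  (hg.comp differentiableOn_cayleyInv fun _ hw ↦ im_cayleyInv_pos hw).div (by fun_prop)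
    fun _ hw ↦ pow_ne_zero _ (one_sub_ne_zero hw)

theorem circleMap_mul_cayleyPullback (g : ℂ → ℂ) {θ : ℝ} (hθ : θ ∈ Ioo 0 (2 * π)) :
    circleMap 0 1 θ * cayleyPullback g (circleMap 0 1 θ) =
      (-1 / 2 : ℂ) * (|1 / (2 * cos ((θ - π) / 2) ^ 2)| • g (angleTan θ)) := by
  have hcos : (cos ((θ - π) / 2) : ℂ) ≠ 0 := by exact_mod_cast (cos_half_angle_pos hθ).ne'
  have hexp := cos_add_sin_mul_I_ne_zero ((θ - π) / 2)
  rw [cayleyPullback, cayleyInv_circleMap hθ, one_sub_circleMap, circleMap_eq_neg_sq,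
    abs_of_nonneg (by positivity), Complex.real_smul]
  push_cast at hcos hexp ⊢
  field_simp

theorem integral_comp_angleTan (g : ℂ → ℂ) :
    ∫ θ in Ioo 0 (2 * π), |1 / (2 * cos ((θ - π) / 2) ^ 2)| • g (angleTan θ) = ∫ t : ℝ, g t := by
  rw [← integral_image_eq_integral_abs_deriv_smul measurableSet_Ioo
    (fun θ hθ ↦ (hasDerivAt_angleTan hθ).hasDerivWithinAt) injOn_angleTan (fun t : ℝ ↦ g t),
    image_angleTan, setIntegral_univ]

theorem integrableOn_comp_angleTan (hg : Integrable fun t : ℝ ↦ g t) :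
    IntegrableOn (fun θ ↦ |1 / (2 * cos ((θ - π) / 2) ^ 2)| • g (angleTan θ)) (Ioo 0 (2 * π)) := by
  rw [← integrableOn_image_iff_integrableOn_abs_deriv_smul measurableSet_Ioo
    (fun θ hθ ↦ (hasDerivAt_angleTan hθ).hasDerivWithinAt) injOn_angleTan (fun t : ℝ ↦ g t)]
  exact hg.integrableOn

theorem circleAverage_mul_cayleyPullback (g : ℂ → ℂ) :
    circleAverage (fun w ↦ w * cayleyPullback g w) 0 1 =
      (2 * π)⁻¹ • ((-1 / 2 : ℂ) * ∫ t : ℝ, g t) := by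
  rw [circleAverage_def, intervalIntegral.integral_of_le two_pi_pos.le,
    integral_Ioc_eq_integral_Ioo, ← integral_comp_angleTan, ← integral_const_mul]
  congr 1
  exact setIntegral_congr_fun measurableSet_Ioo fun θ hθ ↦ circleMap_mul_cayleyPullback g hθ

theorem circleIntegrable_cayleyPullback (hg : Integrable fun t : ℝ ↦ g t) :
    CircleIntegrable (cayleyPullback g) 0 1 := by
  have hunit (θ : ℝ) : ‖(circleMap 0 1 θ)⁻¹‖ = 1 := by simp
  have hmul : IntegrableOn (fun θ ↦ (circleMap 0 1 θ)⁻¹ *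
      ((-1 / 2 : ℂ) * (|1 / (2 * cos ((θ - π) / 2) ^ 2)| • g (angleTan θ)))) (Ioo 0 (2 * π)) :=
    Integrable.bdd_mul (c := 1) ((integrableOn_comp_angleTan hg).const_mul _)
      ((continuous_circleMap 0 1).inv₀ fun θ ↦
        circleMap_ne_center one_ne_zero).aestronglyMeasurable
      (.of_forall fun θ ↦ (hunit θ).le)
  rw [CircleIntegrable, intervalIntegrable_iff_integrableOn_Ioo_of_le two_pi_pos.le]
  refine hmul.congr_fun (fun θ hθ ↦ ?_) measurableSet_Ioo
  simp only [← circleMap_mul_cayleyPullback g hθ]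
  exact inv_mul_cancel_left₀ (circleMap_ne_center one_ne_zero) _

theorem norm_one_sub_sq_le {w : ℂ} (hw : w ∈ ball (0 : ℂ) 1) : ‖(1 - w) ^ 2‖ ≤ 4 := by
  have hw1 : ‖w‖ < 1 := by simpa using hw
  have hle : ‖1 - w‖ ≤ 2 := (norm_sub_le _ _).trans (by rw [norm_one]; linarith)
  rw [norm_pow]
  nlinarith [norm_nonneg (1 - w)]

theorem exists_circleAverage_posLog_cayleyPullback_le (hg : DeBranges.BoundedType g) :
    ∃ M, ∀ᶠ r in 𝓝[<] (1 : ℝ), circleAverage (fun w ↦ log⁺ ‖cayleyPullback g w‖) 0 r ≤ M := by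
  obtain ⟨hgd, p, q, -, hq, ⟨A, hA⟩, ⟨B, hB⟩, ⟨z₀, hz₀, hqz₀⟩, hpq⟩ := hg
  have hA0 : 0 ≤ A := (norm_nonneg _).trans (hA z₀ hz₀)
  have hB0 : 0 ≤ B := (norm_nonneg _).trans (hB z₀ hz₀)
  have hmaps : MapsTo cayleyInv (ball 0 1) {z | 0 < z.im} := fun w hw ↦ im_cayleyInv_pos hw
  set C : ℝ := A + 4 * B + 1
  have hC : 0 < C := by positivity
  have hCnorm : ‖(C : ℂ)‖ = C := Complex.norm_of_nonneg hC.le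
  refine exists_circleAverage_posLog_norm_le (q := fun w ↦ q (cayleyInv w) * (1 - w) ^ 2 / C)
    (w := cayley z₀) (differentiableOn_cayleyPullback hgd) ?_ (fun w hw ↦ ?_) (fun w hw ↦ ?_)
    (cayley_mem_ball hz₀) ?_
  · exact ((hq.comp differentiableOn_cayleyInv hmaps).mul (by fun_prop)).div_const _
  · have hw1 := one_sub_ne_zero hw
    have hp : cayleyPullback g w * (q (cayleyInv w) * (1 - w) ^ 2 / C) = p (cayleyInv w) / C := by
      rw [cayleyPullback, ← hpq _ (hmaps hw)]
      field_simp
    rw [hp, norm_div, hCnorm, div_le_one hC]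
    linarith [hA _ (hmaps hw)]
  · rw [norm_div, hCnorm, div_le_one hC, norm_mul]
    linarith [mul_le_mul (hB _ (hmaps hw)) (norm_one_sub_sq_le hw) (norm_nonneg _) hB0]
  · rw [cayleyInv_cayley hz₀]
    exact div_ne_zero (mul_ne_zero hqz₀ (pow_ne_zero _ (one_sub_ne_zero (cayley_mem_ball hz₀))))
      (by exact_mod_cast hC.ne')

theorem cayleyPullback_cayley {z : ℂ} (hz : 0 < z.im) :
    cayleyPullback g (cayley z) = -1 / 4 * (g z * ((z + Complex.I) * (z + Complex.I))) := by
  have hI := add_I_ne_zero hz.le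
  rw [cayleyPullback, cayleyInv_cayley hz, one_sub_cayley hz.le, div_pow, mul_pow, Complex.I_sq]
  field_simp
  ring

theorem subexpOnImag_cayleyPullback_comp_cayley (hg : SubexpOnImag g) :
    SubexpOnImag (cayleyPullback g ∘ cayley) := by
  have hprod := hg.mul (DeBranges.subexpOnImag_add_I.mul DeBranges.subexpOnImag_add_I)
  refine hprod.of_isBigO
    ((Asymptotics.isBigO_const_mul_self (-1 / 4 : ℂ) _ _).congr' ?_ .rfl)
  filter_upwards [eventually_gt_atTop 0] with y hy
  exact (cayleyPullback_cayley (z := y * Complex.I) (by simpa using hy)).symm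

theorem integral_eq_zero_of_boundedType (hgc : ContinuousOn g {z | 0 ≤ z.im})
    (hgb : DeBranges.BoundedType g) (himag : SubexpOnImag g)
    (hgI : Integrable fun t : ℝ ↦ g t) : ∫ t : ℝ, g t = 0 := by
  set k := cayleyPullback g
  have hk : ContinuousOn k (closedBall 0 1 \ {1}) := continuousOn_cayleyPullback hgc
  have hkd : DifferentiableOn ℂ k (ball 0 1) := differentiableOn_cayleyPullback hgb.1
  have hkI : CircleIntegrable k 0 1 := circleIntegrable_cayleyPullback hgI
  obtain ⟨M, hM⟩ := exists_circleAverage_posLog_cayleyPullback_le hgb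
  have hmul_le {w : ℂ} (hw : w ∈ closedBall (0 : ℂ) 1) : ‖w * k w‖ ≤ ‖k w‖ := by
    rw [norm_mul]
    exact mul_le_of_le_one_left (norm_nonneg _) (by simpa using hw)
  have hmean : circleAverage (fun w ↦ w * k w) 0 1 = 0 * k 0 :=
    circleAverage_eq_of_norm_le_poissonIntegral one_pos (countable_singleton 1) (by simp)
      (continuousOn_id.mul hk) (differentiableOn_id.mul hkd)
      (IntervalIntegrable.continuousOn_mul hkI (continuous_circleMap 0 1).continuousOn)
      (circleIntegrable_max_one_norm hkI)
      (fun w hw ↦ (hmul_le (ball_subset_closedBall hw)).trans (norm_le_poissonIntegral_max_one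
        hk hkd hkI hM (subexpOnImag_cayleyPullback_comp_cayley himag) hw))
      fun z hz ↦ (hmul_le (sphere_subset_closedBall hz)).trans (le_max_right _ _)
  rw [circleAverage_mul_cayleyPullback, zero_mul, smul_eq_zero_iff_right (by positivity)] at hmean
  simpa using hmean

end CayleyPullback

end HardyDisc

namespace DeBranges

open Filter Topology MeasureTheory Asymptotics

section MeanType

variable {f g : ℂ → ℂ}

theorem subexpOnImag_iff_eventually_norm_le :
    SubexpOnImag f ↔ ∀ ε > 0, ∀ᶠ y : ℝ in atTop, ‖f (y * Complex.I)‖ ≤ Real.exp (ε * y) := by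
  constructor
  · intro h ε hε
    have hlt : (fun y : ℝ ↦ Real.exp (ε / 2 * y)) =o[atTop] fun y : ℝ ↦ Real.exp (ε * y) := by
      rw [Real.isLittleO_exp_comp_exp_comp]
      exact (tendsto_id.const_mul_atTop (half_pos hε)).congr fun y ↦ by simp only [id]; ring
    filter_upwards [((h _ (half_pos hε)).trans_isLittleO hlt).bound one_pos] with y hy
    rwa [one_mul, Real.norm_of_nonneg (Real.exp_pos _).le] at hy
  · intro h ε hε
    refine IsBigO.of_bound 1 ((h ε hε).mono fun y hy ↦ ?_)
    rwa [one_mul, Real.norm_of_nonneg (Real.exp_pos _).le]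

theorem log_enorm_div_le_iff {x : ℂ} {y ε : ℝ} (hy : 0 < y) :
    ENNReal.log ‖x‖ₑ / (y : EReal) ≤ ε ↔ ‖x‖ ≤ Real.exp (ε * y) := by
  rw [EReal.div_le_iff_le_mul (by exact_mod_cast hy) (EReal.coe_ne_top y), ← EReal.coe_mul,
    ← EReal.exp_le_exp_iff, ENNReal.exp_log, EReal.exp_coe, ← ofReal_norm,
    ENNReal.ofReal_le_ofReal_iff (Real.exp_pos _).le, mul_comm]

theorem meanType_nonpos_iff : meanType f ≤ 0 ↔ SubexpOnImag f := by
  rw [subexpOnImag_iff_eventually_norm_le]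
  constructor
  · intro h ε hε
    have hlt : meanType f < (ε : EReal) := h.trans_lt (by exact_mod_cast hε)
    filter_upwards [eventually_lt_of_limsup_lt hlt, eventually_gt_atTop 0] with y hy hy0
    exact (log_enorm_div_le_iff hy0).1 hy.le
  · intro h
    refine le_of_forall_gt_imp_ge_of_dense fun c hc ↦ ?_
    obtain ⟨ε, hε0, hεc⟩ := EReal.lt_iff_exists_real_btwn.1 hc
    refine (limsup_le_of_le (by isBoundedDefault) ?_).trans hεc.le
    filter_upwards [h ε (by exact_mod_cast hε0), eventually_gt_atTop 0] with y hy hy0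
    exact (log_enorm_div_le_iff hy0).2 hy

theorem SubexpOnImag.add (hf : SubexpOnImag f) (hg : SubexpOnImag g) :
    SubexpOnImag fun z ↦ f z + g z :=
  fun ε hε ↦ (hf ε hε).add (hg ε hε)

theorem mul_I_mem_upperHalf {y : ℝ} (hy : 0 < y) : (y : ℂ) * Complex.I ∈ upperHalf := by
  simpa [upperHalf] using hy

theorem SubexpOnImag.congr (hf : SubexpOnImag f) (h : Set.EqOn g f upperHalf) :
    SubexpOnImag g :=
  hf.of_isBigO <| EventuallyEq.isBigO <| (eventually_gt_atTop 0).mono fun _ hy ↦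
    h (mul_I_mem_upperHalf hy)

theorem subexpOnImag_of_norm_le {C : ℝ} (hC : ∀ z ∈ upperHalf, ‖f z‖ ≤ C) : SubexpOnImag f :=
  subexpOnImag_iff_eventually_norm_le.2 fun ε hε ↦ by
    have hexp : Tendsto (fun y : ℝ ↦ Real.exp (ε * y)) atTop atTop :=
      Real.tendsto_exp_atTop.comp (tendsto_id.const_mul_atTop hε)
    filter_upwards [hexp.eventually_ge_atTop C, eventually_gt_atTop 0] with y hy hy0
    exact (hC _ (mul_I_mem_upperHalf hy0)).trans hy

end MeanType

section BoundedType

variable {f g p q : ℂ → ℂ}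

theorem isOpen_upperHalf : IsOpen upperHalf := isOpen_lt continuous_const Complex.continuous_im

theorem isPreconnected_upperHalf : IsPreconnected upperHalf :=
  (convex_halfSpace_im_gt 0).isPreconnected

theorem I_mem_upperHalf : Complex.I ∈ upperHalf := by simp [upperHalf]

theorem exists_mul_ne_zero (hp : DifferentiableOn ℂ p upperHalf)
    (hq : DifferentiableOn ℂ q upperHalf) (hp0 : ∃ z ∈ upperHalf, p z ≠ 0)
    (hq0 : ∃ z ∈ upperHalf, q z ≠ 0) : ∃ z ∈ upperHalf, p z * q z ≠ 0 := by
  by_contra! hpq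
  obtain ⟨z, hz, hpz⟩ := hp0
  obtain ⟨w, hw, hqw⟩ := hq0
  have hqn : q =ᶠ[𝓝 z] 0 := by
    filter_upwards [((hp.analyticOnNhd isOpen_upperHalf) z hz).continuousAt.eventually_ne hpz,
      isOpen_upperHalf.mem_nhds hz] with x hx hxu
    exact (mul_eq_zero.1 (hpq x hxu)).resolve_left hx
  exact hqw ((hq.analyticOnNhd isOpen_upperHalf).eqOn_zero_of_preconnected_of_eventuallyEq_zero
    isPreconnected_upperHalf hz hqn hw)

theorem exists_norm_mul_le (hp : ∃ C : ℝ, ∀ z ∈ upperHalf, ‖p z‖ ≤ C)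
    (hq : ∃ C : ℝ, ∀ z ∈ upperHalf, ‖q z‖ ≤ C) :
    ∃ C : ℝ, ∀ z ∈ upperHalf, ‖p z * q z‖ ≤ C := by
  obtain ⟨C, hC⟩ := hp
  obtain ⟨D, hD⟩ := hq
  exact ⟨C * D, fun z hz ↦ norm_mul_le_of_le (hC z hz) (hD z hz)⟩

theorem BoundedType.congr (hf : BoundedType f) (h : Set.EqOn g f upperHalf) :
    BoundedType g := by
  obtain ⟨hd, p, q, hp, hq, hpb, hqb, hq0, hpq⟩ := hf
  exact ⟨hd.congr h, p, q, hp, hq, hpb, hqb, hq0, fun z hz ↦ by rw [h hz, hpq z hz]⟩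

theorem BoundedType.mul (hf : BoundedType f) (hg : BoundedType g) :
    BoundedType fun z ↦ f z * g z := by
  obtain ⟨hd, p, q, hp, hq, hpb, hqb, hq0, hpq⟩ := hf
  obtain ⟨hd', p', q', hp', hq', hpb', hqb', hq0', hpq'⟩ := hg
  refine ⟨hd.mul hd', fun z ↦ p z * p' z, fun z ↦ q z * q' z, hp.mul hp', hq.mul hq',
    exists_norm_mul_le hpb hpb', exists_norm_mul_le hqb hqb', exists_mul_ne_zero hq hq' hq0 hq0',
    fun z hz ↦ ?_⟩
  linear_combination q z * f z * hpq' z hz + p' z * hpq z hz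

theorem BoundedType.add (hf : BoundedType f) (hg : BoundedType g) :
    BoundedType fun z ↦ f z + g z := by
  obtain ⟨hd, p, q, hp, hq, hpb, hqb, hq0, hpq⟩ := hf
  obtain ⟨hd', p', q', hp', hq', hpb', hqb', hq0', hpq'⟩ := hg
  obtain ⟨C, hC⟩ := exists_norm_mul_le hpb hqb'
  obtain ⟨D, hD⟩ := exists_norm_mul_le hpb' hqb
  refine ⟨hd.add hd', fun z ↦ p z * q' z + p' z * q z, fun z ↦ q z * q' z,
    (hp.mul hq').add (hp'.mul hq), hq.mul hq', ⟨C + D, fun z hz ↦ ?_⟩,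
    exists_norm_mul_le hqb hqb', exists_mul_ne_zero hq hq' hq0 hq0', fun z hz ↦ ?_⟩
  · exact norm_add_le_of_le (hC z hz) (hD z hz)
  · linear_combination q' z * hpq z hz + q z * hpq' z hz

theorem boundedType_of_norm_le {C : ℝ} (hf : DifferentiableOn ℂ f upperHalf)
    (hC : ∀ z ∈ upperHalf, ‖f z‖ ≤ C) : BoundedType f :=
  ⟨hf, f, fun _ ↦ 1, hf, by fun_prop, ⟨C, hC⟩, ⟨1, fun z _ ↦ by simp⟩,
    ⟨Complex.I, I_mem_upperHalf, one_ne_zero⟩, fun z _ ↦ mul_one _⟩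

end BoundedType

/-- `f` is of bounded type and of nonpositive mean type in the upper half-plane: the condition
imposed on `f / E` and `f^* / E` for `f` in `H(E)`. -/
structure NonposType (f : ℂ → ℂ) : Prop where
  boundedType : BoundedType f
  subexpOnImag : SubexpOnImag f

section NonposType

variable {f g : ℂ → ℂ}

theorem NonposType.congr (hf : NonposType f) (h : Set.EqOn g f upperHalf) : NonposType g :=
  ⟨hf.1.congr h, hf.2.congr h⟩

theorem NonposType.mul (hf : NonposType f) (hg : NonposType g) :
    NonposType fun z ↦ f z * g z :=
  ⟨hf.1.mul hg.1, hf.2.mul hg.2⟩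

theorem NonposType.add (hf : NonposType f) (hg : NonposType g) :
    NonposType fun z ↦ f z + g z :=
  ⟨hf.1.add hg.1, hf.2.add hg.2⟩

theorem nonposType_of_norm_le {C : ℝ} (hf : DifferentiableOn ℂ f upperHalf)
    (hC : ∀ z ∈ upperHalf, ‖f z‖ ≤ C) : NonposType f :=
  ⟨boundedType_of_norm_le hf hC, subexpOnImag_of_norm_le hC⟩

theorem nonposType_const (c : ℂ) : NonposType fun _ ↦ c :=
  nonposType_of_norm_le (by fun_prop) fun _ _ ↦ le_rfl

theorem NonposType.const_mul (hf : NonposType f) (c : ℂ) : NonposType fun z ↦ c * f z :=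
  (nonposType_const c).mul hf

theorem sub_ofReal_ne_zero {z : ℂ} (hz : z ∈ upperHalf) (x : ℝ) : z - x ≠ 0 := fun h ↦ by
  simpa [h] using (show 0 < (z - x).im by simpa [upperHalf] using hz)

theorem one_le_norm_sub_add_I {z : ℂ} (hz : z ∈ upperHalf) (x : ℝ) :
    1 ≤ ‖z - x + Complex.I‖ := by
  have hz0 : 0 < z.im := hz
  have him : 1 ≤ (z - x + Complex.I).im := by simpa using hz0.le
  exact him.trans ((le_abs_self _).trans (Complex.abs_im_le_norm _))

theorem sub_ofReal_add_I_ne_zero {z : ℂ} (hz : z ∈ upperHalf) (x : ℝ) :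
    z - x + Complex.I ≠ 0 :=
  norm_pos_iff.1 (zero_lt_one.trans_le (one_le_norm_sub_add_I hz x))

variable (x : ℝ)

theorem nonposType_inv_sub_add_I : NonposType fun z ↦ (z - x + Complex.I)⁻¹ := by
  refine nonposType_of_norm_le (C := 1) (fun z hz ↦ ?_) fun z hz ↦ ?_
  · have hne := sub_ofReal_add_I_ne_zero hz x
    fun_prop (disch := assumption)
  · rw [norm_inv]
    exact inv_le_one_of_one_le₀ (one_le_norm_sub_add_I hz x)

theorem boundedType_inv_sub : BoundedType fun z ↦ (z - x)⁻¹ := by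
  have hp := nonposType_inv_sub_add_I x
  refine ⟨fun z hz ↦ ?_, fun z ↦ (z - x + Complex.I)⁻¹, fun z ↦ (z - x) * (z - x + Complex.I)⁻¹,
    hp.1.1, DifferentiableOn.mul (by fun_prop) hp.1.1, ⟨1, fun z hz ↦ ?_⟩, ⟨2, fun z hz ↦ ?_⟩,
    ⟨Complex.I, I_mem_upperHalf, mul_ne_zero (sub_ofReal_ne_zero I_mem_upperHalf x)
      (inv_ne_zero (sub_ofReal_add_I_ne_zero I_mem_upperHalf x))⟩, fun z hz ↦ ?_⟩
  · have hne := sub_ofReal_ne_zero hz x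
    fun_prop (disch := assumption)
  · rw [norm_inv]
    exact inv_le_one_of_one_le₀ (one_le_norm_sub_add_I hz x)
  · have hge := one_le_norm_sub_add_I hz x
    have htri := norm_sub_le (z - x + Complex.I) Complex.I
    rw [add_sub_cancel_right, Complex.norm_I] at htri
    rw [norm_mul, norm_inv, ← div_eq_mul_inv, div_le_iff₀ (by linarith)]
    linarith
  · rw [inv_mul_cancel_left₀ (sub_ofReal_ne_zero hz x)]

theorem subexpOnImag_inv_sub : SubexpOnImag fun z ↦ (z - x)⁻¹ :=
  subexpOnImag_iff_eventually_norm_le.2 fun ε hε ↦ by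
    filter_upwards [eventually_ge_atTop 1] with y hy
    have him := Complex.abs_im_le_norm ((y : ℂ) * Complex.I - x)
    rw [show ((y : ℂ) * Complex.I - x).im = y by simp, abs_of_nonneg (by linarith)] at him
    rw [norm_inv]
    exact (inv_le_one_of_one_le₀ (hy.trans him)).trans (Real.one_le_exp (by positivity))

theorem nonposType_inv_sub : NonposType fun z ↦ (z - x)⁻¹ :=
  ⟨boundedType_inv_sub x, subexpOnImag_inv_sub x⟩

end NonposType

theorem tendsto_ofReal_nhdsNE (x : ℝ) :
    Tendsto (fun t : ℝ ↦ (t : ℂ)) (𝓝[≠] x) (𝓝[≠] (x : ℂ)) :=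
  Complex.continuous_ofReal.continuousAt.continuousWithinAt.tendsto_nhdsWithin fun t ht ↦ by
    simpa using ht

theorem inv_sub_isBigO_of_meromorphicOrderAt_neg {h : ℂ → ℂ} {x : ℂ}
    (hneg : meromorphicOrderAt h x < 0) : (fun z ↦ (z - x)⁻¹) =O[𝓝[≠] x] h := by
  have hm : MeromorphicAt h x := by
    by_contra hm
    simp [meromorphicOrderAt_of_not_meromorphicAt hm] at hneg
  obtain ⟨n, hn⟩ := WithTop.ne_top_iff_exists.1 hneg.ne_top
  have hlin : meromorphicOrderAt (fun z ↦ z - x) x = 1 :=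
    (meromorphicOrderAt_eq_int_iff (n := 1) (by fun_prop)).2
      ⟨1, analyticAt_const, one_ne_zero, by simp⟩
  have horder : 0 ≤ meromorphicOrderAt ((fun z ↦ z - x)⁻¹ / h) x := by
    rw [div_eq_mul_inv, meromorphicOrderAt_mul (by fun_prop) hm.inv, meromorphicOrderAt_inv,
      meromorphicOrderAt_inv, hlin, ← hn]
    have hn0 : n < 0 := WithTop.coe_lt_coe.1 (hn ▸ hneg)
    exact WithTop.coe_le_coe.2 (show 0 ≤ -1 + -n by omega)
  obtain ⟨c, hc⟩ := tendsto_nhds_of_meromorphicOrderAt_nonneg (by fun_prop) horder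
  have hne : ∀ᶠ z in 𝓝[≠] x, h z ≠ 0 :=
    (meromorphicOrderAt_ne_top_iff_eventually_ne_zero hm).1 hneg.ne_top
  exact Asymptotics.isBigO_of_div_tendsto_nhds (hne.mono fun z hz h0 ↦ absurd h0 hz) c hc

theorem meromorphicOrderAt_nonneg_of_intervalIntegrable {h : ℂ → ℂ} {x a b : ℝ}
    (hab : a ≠ b) (hx : x ∈ Set.uIcc a b)
    (hI : IntervalIntegrable (fun t : ℝ ↦ h t) volume a b) :
    0 ≤ meromorphicOrderAt h (x : ℂ) := by
  by_contra! hneg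
  refine not_intervalIntegrable_of_sub_inv_isBigO_punctured ?_ hab hx hI
  refine (Asymptotics.isBigO_of_le _ fun t ↦ ?_).trans
    ((inv_sub_isBigO_of_meromorphicOrderAt_neg hneg).comp_tendsto (tendsto_ofReal_nhdsNE x))
  rw [Function.comp_apply, ← Complex.ofReal_sub, ← Complex.ofReal_inv, Complex.norm_real]

theorem exists_analyticOnNhd_of_meromorphicOrderAt_nonneg {h : ℂ → ℂ} {s : Set ℂ}
    (hm : MeromorphicOn h Set.univ) (hs : ∀ z ∈ s, 0 ≤ meromorphicOrderAt h z) :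
    ∃ g : ℂ → ℂ, AnalyticOnNhd ℂ g s ∧ ∀ z, AnalyticAt ℂ h z → g z = h z := by
  refine ⟨toMeromorphicNFOn h Set.univ, fun z hz ↦ ?_, fun z hz ↦ ?_⟩
  · rw [← (meromorphicNFOn_toMeromorphicNFOn h Set.univ
      (Set.mem_univ z)).meromorphicOrderAt_nonneg_iff_analyticAt,
      meromorphicOrderAt_toMeromorphicNFOn hm (Set.mem_univ z)]
    exact hs z hz
  · rw [toMeromorphicNFOn_eq_toMeromorphicNFAt hm (Set.mem_univ z),
      toMeromorphicNFAt_eq_self.2 hz.meromorphicNFAt]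

theorem eventually_nhdsNE_ne_zero {D : ℂ → ℂ} (hD : Differentiable ℂ D) {z₀ : ℂ}
    (h₀ : D z₀ ≠ 0) (z : ℂ) : ∀ᶠ w in 𝓝[≠] z, D w ≠ 0 := by
  have hDa : AnalyticOnNhd ℂ D Set.univ := fun z _ ↦ hD.analyticAt z
  have hcod : D ⁻¹' {0}ᶜ ∈ codiscrete ℂ := hDa.preimage_zero_mem_codiscrete h₀
  simp only [mem_codiscrete, disjoint_principal_right, compl_compl] at hcod
  exact hcod z

theorem ae_ne_zero {D : ℂ → ℂ} (hD : Differentiable ℂ D) {z₀ : ℂ} (h₀ : D z₀ ≠ 0) :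
    ∀ᵐ t : ℝ, D t ≠ 0 := by
  have hreal : {t : ℝ | D t ≠ 0} ∈ codiscreteWithin (Set.univ : Set ℝ) := by
    simp only [mem_codiscreteWithin, disjoint_principal_right]
    intro x _
    filter_upwards [(tendsto_ofReal_nhdsNE x).eventually (eventually_nhdsNE_ne_zero hD h₀ x)]
      with t ht
    simpa using ht
  rw [← Measure.restrict_univ (μ := volume)]
  exact ae_restrict_le_codiscreteWithin MeasurableSet.univ hreal

theorem integral_div_eq_zero {N D : ℂ → ℂ} (hN : Differentiable ℂ N) (hD : Differentiable ℂ D)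
    (hD0 : ∀ z ∈ upperHalf, D z ≠ 0) (hND : NonposType fun z ↦ N z / D z)
    (hI : Integrable fun t : ℝ ↦ N t / D t) : ∫ t : ℝ, N t / D t = 0 := by
  have hquot : ∀ z, D z ≠ 0 → AnalyticAt ℂ (fun z ↦ N z / D z) z := fun z hz ↦
    (hN.analyticAt z).div (hD.analyticAt z) hz
  have horder : ∀ z ∈ {z : ℂ | 0 ≤ z.im}, 0 ≤ meromorphicOrderAt (fun z ↦ N z / D z) z := by
    intro z hz
    rcases eq_or_lt_of_le (Set.mem_ofPred.1 hz) with hreal | hupper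
    · lift z to ℝ using hreal.symm
      exact meromorphicOrderAt_nonneg_of_intervalIntegrable (a := z) (b := z + 1)
        (by simp) Set.left_mem_uIcc hI.intervalIntegrable
    · exact (hquot z (hD0 z hupper)).meromorphicOrderAt_nonneg
  obtain ⟨g, hg, hgND⟩ := exists_analyticOnNhd_of_meromorphicOrderAt_nonneg
    (fun z _ ↦ (hN.analyticAt z).meromorphicAt.div (hD.analyticAt z).meromorphicAt) horder
  have hae : (fun t : ℝ ↦ g t) =ᵐ[volume] fun t : ℝ ↦ N t / D t := by
    filter_upwards [ae_ne_zero hD (hD0 _ I_mem_upperHalf)] with t ht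
    exact hgND _ (hquot _ ht)
  have hgtype : NonposType g := hND.congr fun z hz ↦ hgND z (hquot z (hD0 z hz))
  rw [← integral_congr_ae hae]
  exact HardyDisc.integral_eq_zero_of_boundedType hg.continuousOn hgtype.boundedType
    hgtype.subexpOnImag (hI.congr hae.symm)

section MemLp

theorem memLp_inv_sub_add_I (x : ℝ) : MemLp (fun t : ℝ ↦ ((t : ℂ) - x + Complex.I)⁻¹) 2 := by
  have hne : ∀ t : ℝ, (t : ℂ) - x + Complex.I ≠ 0 := fun t h ↦ by
    simpa using congrArg Complex.im h
  have hmeas : AEStronglyMeasurable (fun t : ℝ ↦ ((t : ℂ) - x + Complex.I)⁻¹) :=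
    (Continuous.inv₀ (by fun_prop) hne).aestronglyMeasurable
  rw [memLp_two_iff_integrable_sq_norm hmeas]
  refine (integrable_inv_one_add_sq.comp_sub_right x).congr (ae_of_all _ fun t ↦ ?_)
  dsimp only
  rw [norm_inv, inv_pow, Complex.sq_norm, Complex.normSq_apply]
  simp only [Complex.add_re, Complex.add_im, Complex.sub_re, Complex.sub_im, Complex.ofReal_re,
    Complex.ofReal_im, Complex.I_re, Complex.I_im]
  ring

variable {u : ℝ → ℂ} {x : ℝ} {p q : ENNReal}

theorem memLp_self_of_memLp_sub_mul (hu : ContinuousAt u x) (hmeas : AEStronglyMeasurable u)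
    (h : MemLp (fun t : ℝ ↦ ((t : ℂ) - x) * u t) p) : MemLp u p := by
  obtain ⟨δ, hδ, hball⟩ := Metric.continuousAt_iff.1 hu 1 one_pos
  have hnear : MemLp ((Metric.ball x δ).indicator u) p := by
    rw [memLp_indicator_iff_restrict measurableSet_ball]
    have : IsFiniteMeasure (volume.restrict (Metric.ball x δ)) :=
      isFiniteMeasure_restrict.2 measure_ball_lt_top.ne
    refine MemLp.of_bound hmeas.restrict (1 + ‖u x‖) ?_
    filter_upwards [ae_restrict_mem measurableSet_ball] with t ht
    have := norm_le_norm_add_norm_sub' (u t) (u x)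
    have := dist_eq_norm (u t) (u x) ▸ hball ht
    linarith
  have hfar : MemLp ((Metric.ball x δ)ᶜ.indicator u) p := by
    refine h.of_le_mul (c := δ⁻¹) (hmeas.indicator measurableSet_ball.compl)
      (ae_of_all _ fun t ↦ ?_)
    by_cases ht : t ∈ Metric.ball x δ
    · simp only [Set.mem_compl_iff, ht, not_true_eq_false, not_false_eq_true,
        Set.indicator_of_notMem, norm_zero]
      positivity
    · rw [Set.indicator_of_mem (Set.mem_compl ht), norm_mul, ← mul_assoc]
      refine le_mul_of_one_le_left (norm_nonneg _) ?_
      rw [← Complex.ofReal_sub, Complex.norm_real, inv_mul_eq_div, one_le_div₀ hδ, ← dist_eq_norm]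
      exact not_lt.1 ht
  simpa using hnear.add hfar

theorem memLp_of_memLp_sub_mul [ENNReal.HolderTriple 2 p q] (hu : ContinuousAt u x)
    (hmeas : AEStronglyMeasurable u) (h : MemLp (fun t : ℝ ↦ ((t : ℂ) - x) * u t) p) :
    MemLp u q := by
  have hmul : MemLp (fun t : ℝ ↦ ((t : ℂ) - x + Complex.I) * u t) p := by
    simp only [add_mul]
    exact h.add ((memLp_self_of_memLp_sub_mul hu hmeas h).const_mul Complex.I)
  refine (memLp_congr_ae (ae_of_all _ fun t ↦ ?_)).1 (hmul.mul (memLp_inv_sub_add_I x))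
  exact inv_mul_cancel_left₀ (fun h ↦ by simpa using congrArg Complex.im h) _

end MemLp

section Sharp

variable {f : ℂ → ℂ}

theorem sharp_sharp (f : ℂ → ℂ) : sharp (sharp f) = f := by
  ext z; simp [sharp]

theorem sharp_mul (f g : ℂ → ℂ) : sharp (f * g) = sharp f * sharp g := by
  ext z; simp [sharp]

theorem sharp_add (f g : ℂ → ℂ) : sharp (f + g) = sharp f + sharp g := by
  ext z; simp [sharp]

theorem sharp_smul (c : ℂ) (f : ℂ → ℂ) : sharp (c • f) = conj c • sharp f := by
  ext z; simp [sharp]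

theorem sharp_ofReal (f : ℂ → ℂ) (t : ℝ) : sharp f t = conj (f t) := by
  simp [sharp]

theorem differentiable_sharp (hf : Differentiable ℂ f) : Differentiable ℂ (sharp f) := fun z ↦ by
  have h := (hf (conj z)).conj_conj
  rwa [Complex.conj_conj] at h

end Sharp

section HermiteBiehler

variable {E F : ℂ → ℂ}

theorem HermiteBiehler.ne_zero (hE : HermiteBiehler E) {z : ℂ} (hz : z ∈ upperHalf) : E z ≠ 0 :=
  norm_pos_iff.1 ((norm_nonneg _).trans_lt (hE.2 z hz))

theorem HermiteBiehler.norm_sharp_le (hE : HermiteBiehler E) {z : ℂ} (hz : z ∈ upperHalf) :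
    ‖sharp E z‖ ≤ ‖E z‖ := by
  rw [sharp, RCLike.norm_conj]
  exact (hE.2 z hz).le

theorem HermiteBiehler.ae_ne_zero (hE : HermiteBiehler E) : ∀ᵐ t : ℝ, E t ≠ 0 :=
  DeBranges.ae_ne_zero hE.1 (hE.ne_zero I_mem_upperHalf)

theorem HermiteBiehler.mul (hE : HermiteBiehler E) (hF : HermiteBiehler F) :
    HermiteBiehler (E * F) := by
  refine ⟨hE.1.mul hF.1, fun z hz ↦ ?_⟩
  rw [Pi.mul_apply, Pi.mul_apply, norm_mul, norm_mul]
  exact mul_lt_mul'' (hE.2 z hz) (hF.2 z hz) (norm_nonneg _) (norm_nonneg _)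

theorem HermiteBiehler.nonposType_div (hE : HermiteBiehler E) {C : ℂ → ℂ}
    (hC : Differentiable ℂ C) (hCE : ∀ z ∈ upperHalf, ‖C z‖ ≤ ‖E z‖) :
    NonposType fun z ↦ C z / E z := by
  refine nonposType_of_norm_le (C := 1)
    (hC.differentiableOn.div hE.1.differentiableOn fun z hz ↦ hE.ne_zero hz) fun z hz ↦ ?_
  rw [norm_div]
  exact div_le_one_of_le₀ (hCE z hz) (norm_nonneg _)

end HermiteBiehler

section Space

variable {E F f g : ℂ → ℂ}

theorem aestronglyMeasurable_div_ofReal (hf : Continuous f) (hE : Continuous E) :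
    AEStronglyMeasurable fun t : ℝ ↦ f t / E t :=
  ((hf.measurable.comp Complex.measurable_ofReal).div
    (hE.measurable.comp Complex.measurable_ofReal)).aestronglyMeasurable

theorem normSq_eq_eLpNorm_sq (E f : ℂ → ℂ) :
    normSq E f = eLpNorm (fun t : ℝ ↦ f t / E t) 2 volume ^ 2 := by
  simpa [normSq] using (eLpNorm_nnreal_pow_eq_lintegral (μ := volume)
    (f := fun t : ℝ ↦ f t / E t) (p := 2) two_ne_zero).symm

theorem normSq_lt_top_iff (hf : Continuous f) (hE : Continuous E) :
    normSq E f < ⊤ ↔ MemLp (fun t : ℝ ↦ f t / E t) 2 := by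
  rw [normSq_eq_eLpNorm_sq, MemLp, and_iff_right (aestronglyMeasurable_div_ofReal hf hE)]
  simp

theorem mem_space_iff (hE : Continuous E) :
    f ∈ space E ↔ Differentiable ℂ f ∧ MemLp (fun t : ℝ ↦ f t / E t) 2 ∧
      NonposType (fun z ↦ f z / E z) ∧ NonposType (fun z ↦ sharp f z / E z) := by
  simp only [space, Set.mem_ofPred_eq, meanType_nonpos_iff]
  constructor
  · rintro ⟨hd, hn, hb, hm, hb', hm'⟩
    exact ⟨hd, (normSq_lt_top_iff hd.continuous hE).1 hn, ⟨hb, hm⟩, ⟨hb', hm'⟩⟩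
  · rintro ⟨hd, hL, hT, hT'⟩
    exact ⟨hd, (normSq_lt_top_iff hd.continuous hE).2 hL, hT.1, hT.2, hT'.1, hT'.2⟩

theorem add_mem_space (hE : Continuous E) (hf : f ∈ space E) (hg : g ∈ space E) :
    f + g ∈ space E := by
  rw [mem_space_iff hE] at *
  obtain ⟨hfd, hfL, hfT, hfT'⟩ := hf
  obtain ⟨hgd, hgL, hgT, hgT'⟩ := hg
  refine ⟨hfd.add hgd, ?_, ?_, ?_⟩
  · simp only [Pi.add_apply, add_div]
    exact hfL.add hgL
  · simpa only [Pi.add_apply, add_div] using hfT.add hgT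
  · simpa only [sharp_add, Pi.add_apply, add_div] using hfT'.add hgT'

theorem smul_mem_space (hE : Continuous E) (c : ℂ) (hf : f ∈ space E) : c • f ∈ space E := by
  rw [mem_space_iff hE] at *
  obtain ⟨hd, hL, hT, hT'⟩ := hf
  refine ⟨hd.const_smul c, ?_, ?_, ?_⟩
  · simpa only [Pi.smul_apply, smul_eq_mul, mul_div_assoc] using hL.const_mul c
  · simpa only [Pi.smul_apply, smul_eq_mul, mul_div_assoc] using hT.const_mul c
  · simpa only [sharp_smul, Pi.smul_apply, smul_eq_mul, mul_div_assoc] using hT'.const_mul (conj c)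

theorem zero_mem_space (hE : Continuous E) : (0 : ℂ → ℂ) ∈ space E := by
  have hzero : NonposType fun z ↦ (0 : ℂ → ℂ) z / E z := by simpa using nonposType_const 0
  have hsharp : sharp 0 = 0 := by ext z; simp [sharp]
  exact (mem_space_iff hE).2 ⟨differentiable_const 0, by simp, hzero, by rwa [hsharp]⟩

theorem sharp_mem_space (hE : Continuous E) (hf : f ∈ space E) : sharp f ∈ space E := by
  rw [mem_space_iff hE] at *
  obtain ⟨hd, hL, hT, hT'⟩ := hf
  have hd' := differentiable_sharp hd
  refine ⟨hd', hL.of_le (aestronglyMeasurable_div_ofReal hd'.continuous hE) ?_, hT', ?_⟩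
  · refine ae_of_all _ fun t ↦ ?_
    rw [sharp_ofReal, norm_div, norm_div, RCLike.norm_conj]
  · rwa [sharp_sharp]

theorem mul_mem_space {A B C : ℂ → ℂ} (hA : Continuous A) (hB : HermiteBiehler B)
    (hC : Differentiable ℂ C) (hCB : ∀ z ∈ upperHalf, ‖C z‖ ≤ ‖B z‖)
    (hCB' : ∀ z ∈ upperHalf, ‖sharp C z‖ ≤ ‖B z‖) (hCBr : ∀ t : ℝ, ‖C t‖ ≤ ‖B t‖)
    (hf : f ∈ space A) : f * C ∈ space (A * B) := by
  have hAB : Continuous (A * B) := hA.mul hB.1.continuous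
  rw [mem_space_iff hA] at hf
  rw [mem_space_iff hAB]
  obtain ⟨hd, hL, hT, hT'⟩ := hf
  have hfC := hd.mul hC
  refine ⟨hfC, hL.of_le (aestronglyMeasurable_div_ofReal hfC.continuous hAB) ?_, ?_, ?_⟩
  · refine ae_of_all _ fun t ↦ ?_
    rw [Pi.mul_apply, Pi.mul_apply, mul_div_mul_comm, norm_mul, norm_div (C t)]
    exact mul_le_of_le_one_right (norm_nonneg _) (div_le_one_of_le₀ (hCBr t) (norm_nonneg _))
  · simpa only [Pi.mul_apply, mul_div_mul_comm] using hT.mul (hB.nonposType_div hC hCB)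
  · simpa only [sharp_mul, Pi.mul_apply, mul_div_mul_comm] using
      hT'.mul (hB.nonposType_div (differentiable_sharp hC) hCB')

theorem mul_mem_space_self (hE : Continuous E) (hF : HermiteBiehler F) (hf : f ∈ space E) :
    f * F ∈ space (E * F) :=
  mul_mem_space hE hF hF.1 (fun _ _ ↦ le_rfl) (fun _ hz ↦ hF.norm_sharp_le hz) (fun _ ↦ le_rfl) hf

theorem mul_sharp_mem_space (hE : HermiteBiehler E) (hF : Continuous F) (hg : g ∈ space F) :
    g * sharp E ∈ space (E * F) := by
  rw [mul_comm E F]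
  refine mul_mem_space hF hE (differentiable_sharp hE.1) (fun _ hz ↦ hE.norm_sharp_le hz)
    (fun _ _ ↦ by rw [sharp_sharp]) (fun t ↦ ?_) hg
  rw [sharp_ofReal, RCLike.norm_conj]

end Space

section Kernel

variable {E : ℂ → ℂ}

theorem kernelNum_ofReal (E : ℂ → ℂ) (x : ℝ) (z : ℂ) :
    kernelNum E x z = conj (E x) * E z - E x * sharp E z := by
  rw [kernelNum, Complex.conj_ofReal]

theorem kernelNum_self (E : ℂ → ℂ) (x : ℝ) : kernelNum E x x = 0 := by
  rw [kernelNum_ofReal, sharp_ofReal]; ring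

theorem differentiable_kernelNum (hE : Differentiable ℂ E) (w : ℂ) :
    Differentiable ℂ (kernelNum E w) :=
  (hE.const_mul _).sub ((differentiable_sharp hE).const_mul _)

theorem kernel_ofReal_eq_dslope (E : ℂ → ℂ) (x : ℝ) (z : ℂ) :
    kernel E x z = -(2 * Real.pi * Complex.I)⁻¹ * dslope (kernelNum E x) x z := by
  rw [kernel, Complex.conj_ofReal]
  split_ifs with h
  · rw [h, dslope_same]; ring
  · rw [dslope_of_ne _ h, slope_def_field, kernelNum_self, sub_zero, ← neg_sub z, mul_neg, div_neg,
      div_eq_mul_inv, mul_inv, div_eq_mul_inv]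
    ring

theorem sub_mul_kernel (E : ℂ → ℂ) (x : ℝ) (z : ℂ) :
    (z - x) * kernel E x z = -(2 * Real.pi * Complex.I)⁻¹ * kernelNum E x z := by
  have := sub_smul_dslope (kernelNum E x) x z
  rw [kernelNum_self, sub_zero, smul_eq_mul] at this
  rw [kernel_ofReal_eq_dslope, ← this]; ring

theorem differentiable_dslope {f : ℂ → ℂ} (hf : Differentiable ℂ f) (a : ℂ) :
    Differentiable ℂ (dslope f a) := by
  rw [← differentiableOn_univ, Complex.differentiableOn_dslope univ_mem]
  exact hf.differentiableOn

theorem differentiable_kernel (hE : Differentiable ℂ E) (x : ℝ) :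
    Differentiable ℂ (kernel E x) := by
  rw [funext (kernel_ofReal_eq_dslope E x)]
  exact (differentiable_dslope (differentiable_kernelNum hE x) x).const_mul _

theorem eq_of_sub_mul_eq {f g : ℂ → ℂ} (hf : Continuous f) (hg : Continuous g) {a : ℂ}
    (h : ∀ z, (z - a) * f z = (z - a) * g z) : f = g :=
  Continuous.ext_on (dense_compl_singleton a) hf hg fun z hz ↦
    mul_left_cancel₀ (sub_ne_zero.2 hz) (h z)

theorem conj_kernelNum_conj (E : ℂ → ℂ) (x : ℝ) (z : ℂ) :
    conj (kernelNum E x (conj z)) = -kernelNum E x z := by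
  simp [kernelNum_ofReal, sharp]

theorem sharp_kernel_ofReal (hE : Differentiable ℂ E) (x : ℝ) :
    sharp (kernel E x) = kernel E x := by
  have hK := differentiable_kernel hE x
  refine eq_of_sub_mul_eq (a := x) (differentiable_sharp hK).continuous hK.continuous fun z ↦ ?_
  have h := congrArg conj (sub_mul_kernel E x (conj z))
  rw [map_mul, map_mul, conj_kernelNum_conj] at h
  rw [sub_mul_kernel, sharp]
  simpa [Complex.conj_ofNat] using h

theorem kernel_eq_zero (hE : Differentiable ℂ E) {x : ℝ} (hx : E x = 0) : kernel E x = 0 := by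
  refine eq_of_sub_mul_eq (a := x) (differentiable_kernel hE x).continuous continuous_zero
    fun z ↦ ?_
  simp [sub_mul_kernel, kernelNum_ofReal, hx]

theorem nonposType_kernel_div (hE : HermiteBiehler E) (x : ℝ) :
    NonposType fun z ↦ kernel E x z / E z := by
  have hsharp : NonposType fun z ↦ sharp E z / E z :=
    hE.nonposType_div (differentiable_sharp hE.1) fun z hz ↦ hE.norm_sharp_le hz
  have hnum : NonposType fun z ↦ conj (E x) + -E x * (sharp E z / E z) :=
    (nonposType_const _).add (hsharp.const_mul _)
  refine ((hnum.mul (nonposType_inv_sub x)).const_mul (-(2 * Real.pi * Complex.I)⁻¹)).congr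
    fun z hz ↦ ?_
  have hEz := hE.ne_zero hz
  have hzx := sub_ofReal_ne_zero hz x
  rw [← mul_right_inj' hzx, ← mul_div_assoc, sub_mul_kernel, kernelNum_ofReal]
  field_simp
  ring

theorem continuousAt_div_ofReal {f : ℂ → ℂ} (hf : Continuous f) (hE : Continuous E) {x : ℝ}
    (hx : E x ≠ 0) : ContinuousAt (fun t : ℝ ↦ f t / E t) x :=
  (hf.comp Complex.continuous_ofReal).continuousAt.div
    (hE.comp Complex.continuous_ofReal).continuousAt hx

theorem norm_kernelNum_div_le (E : ℂ → ℂ) (x t : ℝ) :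
    ‖kernelNum E x t / E t‖ ≤ 2 * ‖E x‖ := by
  rw [norm_div]
  refine div_le_of_le_mul₀ (norm_nonneg _) (by positivity) ?_
  calc ‖kernelNum E x t‖ ≤ ‖conj (E x) * E t‖ + ‖E x * conj (E t)‖ := by
        rw [kernelNum_ofReal, sharp_ofReal]
        exact norm_sub_le _ _
    _ = 2 * ‖E x‖ * ‖E t‖ := by
        rw [norm_mul, norm_mul, RCLike.norm_conj, RCLike.norm_conj]
        ring

theorem memLp_kernel_div (hE : Differentiable ℂ E) (x : ℝ) :
    MemLp (fun t : ℝ ↦ kernel E x t / E t) 2 := by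
  by_cases hx : E x = 0
  · simp [kernel_eq_zero hE hx]
  have hK := (differentiable_kernel hE x).continuous
  refine memLp_of_memLp_sub_mul (p := ⊤) (continuousAt_div_ofReal hK hE.continuous hx)
    (aestronglyMeasurable_div_ofReal hK hE.continuous) ?_
  have hbdd : MemLp (fun t : ℝ ↦ kernelNum E x t / E t) ⊤ :=
    memLp_top_of_bound (aestronglyMeasurable_div_ofReal (differentiable_kernelNum hE x).continuous
      hE.continuous) _ (ae_of_all _ fun t ↦ norm_kernelNum_div_le E x t)
  simpa only [← mul_div_assoc, sub_mul_kernel] using hbdd.const_mul (-(2 * Real.pi * Complex.I)⁻¹)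

theorem kernel_mem_space (hE : HermiteBiehler E) (x : ℝ) : kernel E x ∈ space E := by
  refine (mem_space_iff hE.1.continuous).2 ⟨differentiable_kernel hE.1 x, memLp_kernel_div hE.1 x,
    nonposType_kernel_div hE x, ?_⟩
  rw [sharp_kernel_ofReal hE.1]
  exact nonposType_kernel_div hE x

end Kernel

section Reproducing

variable {E F f g : ℂ → ℂ}

theorem eq_zero_of_mem_space (hE : HermiteBiehler E) (hf : f ∈ space E) {x : ℝ} (hx : E x = 0) :
    f x = 0 := by
  obtain ⟨hd, hL, -, -⟩ := (mem_space_iff hE.1.continuous).1 hf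
  have hI : IntervalIntegrable (fun t : ℝ ↦ f t / E t) volume x (x + 1) := by
    rw [intervalIntegrable_iff, Set.uIoc_of_le (by linarith)]
    exact (hL.restrict _).integrable one_le_two
  obtain ⟨c, hc⟩ := tendsto_nhds_of_meromorphicOrderAt_nonneg
    ((hd.analyticAt x).meromorphicAt.div (hE.1.analyticAt x).meromorphicAt)
    (meromorphicOrderAt_nonneg_of_intervalIntegrable (by simp) Set.left_mem_uIcc hI)
  have hmul : Tendsto (fun z ↦ f z / E z * E z) (𝓝[≠] (x : ℂ)) (𝓝 (c * E x)) :=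
    hc.mul (hE.1.continuous.continuousAt.tendsto.mono_left nhdsWithin_le_nhds)
  have hlim : Tendsto f (𝓝[≠] (x : ℂ)) (𝓝 (c * E x)) := by
    refine hmul.congr' ?_
    filter_upwards [eventually_nhdsNE_ne_zero hE.1 (hE.ne_zero I_mem_upperHalf) x] with z hz
    exact div_mul_cancel₀ _ hz
  rw [tendsto_nhds_unique (hd.continuous.continuousAt.tendsto.mono_left nhdsWithin_le_nhds) hlim,
    hx, mul_zero]

/-- The entire function `C` for which `C(z) / (E(z) (z - x + i))` is the difference quotient
`(E(x) f(z) / E(z) - f(x) i / (z - x + i)) / (z - x)`. The term `i / (z - x + i)`, which equals `1`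
at `x`, makes the quotient integrable on the real axis. -/
noncomputable def cauchyNum (E f : ℂ → ℂ) (x : ℝ) : ℂ → ℂ :=
  dslope (fun z ↦ E x * f z * (z - x + Complex.I) - Complex.I * f x * E z) x

theorem sub_mul_cauchyNum (E f : ℂ → ℂ) (x : ℝ) (z : ℂ) : (z - x) * cauchyNum E f x z =
    E x * f z * (z - x + Complex.I) - Complex.I * f x * E z := by
  have := sub_smul_dslope
    (fun z ↦ E x * f z * (z - x + Complex.I) - Complex.I * f x * E z) (x : ℂ) z
  rw [smul_eq_mul] at this
  rw [cauchyNum, this]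
  ring

theorem differentiable_cauchyNum (hE : Differentiable ℂ E) (hf : Differentiable ℂ f) (x : ℝ) :
    Differentiable ℂ (cauchyNum E f x) :=
  differentiable_dslope (by fun_prop) _

theorem sub_mul_cauchyNum_div {x : ℝ} {z : ℂ} (hz : E z ≠ 0) (hzx : z - x + Complex.I ≠ 0) :
    (z - x) * (cauchyNum E f x z / (E z * (z - x + Complex.I))) =
      E x * (f z / E z) + -(f x * Complex.I) * (z - x + Complex.I)⁻¹ := by
  rw [← mul_div_assoc, sub_mul_cauchyNum]
  field_simp
  ring

theorem nonposType_cauchyNum_div (hE : HermiteBiehler E) (hf : f ∈ space E) (x : ℝ) :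
    NonposType fun z ↦ cauchyNum E f x z / (E z * (z - x + Complex.I)) := by
  obtain ⟨-, -, hT, -⟩ := (mem_space_iff hE.1.continuous).1 hf
  refine (((hT.const_mul (E x)).add ((nonposType_inv_sub_add_I x).const_mul
    (-(f x * Complex.I)))).mul (nonposType_inv_sub x)).congr fun z hz ↦ ?_
  dsimp only
  rw [← sub_mul_cauchyNum_div (hE.ne_zero hz) (sub_ofReal_add_I_ne_zero hz x),
    mul_right_comm, mul_inv_cancel₀ (sub_ofReal_ne_zero hz x), one_mul]

theorem ofReal_sub_add_I_ne_zero (x t : ℝ) : (t : ℂ) - x + Complex.I ≠ 0 := fun h ↦ by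
  simpa using congrArg Complex.im h

theorem integrable_cauchyNum_div (hE : HermiteBiehler E) (hf : f ∈ space E) {x : ℝ}
    (hx : E x ≠ 0) :
    Integrable fun t : ℝ ↦ cauchyNum E f x t / (E t * (t - x + Complex.I)) := by
  obtain ⟨hd, hL, -, -⟩ := (mem_space_iff hE.1.continuous).1 hf
  have hN : Continuous (cauchyNum E f x) := (differentiable_cauchyNum hE.1 hd x).continuous
  let D : ℂ → ℂ := fun z ↦ E z * (z - x + Complex.I)
  have hD : Continuous D := hE.1.continuous.mul (by fun_prop)
  have hcont : ContinuousAt (fun t : ℝ ↦ cauchyNum E f x t / D t) x :=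
    continuousAt_div_ofReal hN hD (mul_ne_zero hx (ofReal_sub_add_I_ne_zero x x))
  have hmeas : AEStronglyMeasurable fun t : ℝ ↦ cauchyNum E f x t / D t :=
    aestronglyMeasurable_div_ofReal hN hD
  have hsum : MemLp (fun t : ℝ ↦ E x * (f t / E t) +
      -(f x * Complex.I) * ((t : ℂ) - x + Complex.I)⁻¹) 2 :=
    (hL.const_mul (E x)).add ((memLp_inv_sub_add_I x).const_mul (-(f x * Complex.I)))
  have hmul : MemLp (fun t : ℝ ↦ ((t : ℂ) - x) * (cauchyNum E f x t / D t)) 2 := by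
    refine (memLp_congr_ae ?_).2 hsum
    filter_upwards [hE.ae_ne_zero] with t ht
    exact sub_mul_cauchyNum_div ht (ofReal_sub_add_I_ne_zero x t)
  exact memLp_one_iff_integrable.1 (memLp_of_memLp_sub_mul (p := 2) hcont hmeas hmul)

theorem integral_cauchyNum_div (hE : HermiteBiehler E) (hf : f ∈ space E) {x : ℝ}
    (hx : E x ≠ 0) : ∫ t : ℝ, cauchyNum E f x t / (E t * (t - x + Complex.I)) = 0 :=
  integral_div_eq_zero (D := fun z ↦ E z * (z - x + Complex.I))
    (differentiable_cauchyNum hE.1 hf.1 x) (hE.1.mul (by fun_prop))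
    (fun z hz ↦ mul_ne_zero (hE.ne_zero hz) (sub_ofReal_add_I_ne_zero hz x))
    (nonposType_cauchyNum_div hE hf x) (integrable_cauchyNum_div hE hf hx)

theorem mul_conj_kernel_div (f : ℂ → ℂ) {x t : ℝ} (ht : E t ≠ 0) (htx : t ≠ x) :
    f t * conj (kernel E x t) / ((‖E t‖ ^ 2 : ℝ) : ℂ) =
      (2 * Real.pi * Complex.I)⁻¹ * (cauchyNum E f x t / (E t * (t - x + Complex.I)) -
        conj (cauchyNum E (sharp f) x t / (E t * (t - x + Complex.I))) +
        2 * Complex.I * f x * ((1 + (t - x) ^ 2)⁻¹ : ℝ)) := by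
  have hs : (t : ℂ) - x ≠ 0 := sub_ne_zero.2 (Complex.ofReal_injective.ne htx)
  have hplus := ofReal_sub_add_I_ne_zero x t
  have hminus : (t : ℂ) - x - Complex.I ≠ 0 := fun h ↦ by simpa using congrArg Complex.im h
  have hconj : conj (E t) ≠ 0 := (map_ne_zero conj).2 ht
  have hnorm : ((‖E t‖ ^ 2 : ℝ) : ℂ) = E t * conj (E t) := by
    rw [Complex.mul_conj, Complex.normSq_eq_norm_sq]
  have hker : (t - x) * conj (kernel E x t) =
      (2 * Real.pi * Complex.I)⁻¹ * (E x * conj (E t) - conj (E x) * E t) := by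
    have h := congrArg conj (sub_mul_kernel E x t)
    simpa [kernelNum_ofReal, sharp_ofReal, Complex.conj_ofNat] using h
  have hquot := sub_mul_cauchyNum_div (f := f) ht hplus
  have hquot' : (t - x) * conj (cauchyNum E (sharp f) x t / (E t * (t - x + Complex.I))) =
      conj (E x) * (f t / conj (E t)) + f x * Complex.I * ((t : ℂ) - x - Complex.I)⁻¹ := by
    have h := congrArg conj (sub_mul_cauchyNum_div (f := sharp f) ht hplus)
    simpa [sharp_ofReal, sub_eq_add_neg] using h
  have hpoisson : (((1 + (t - x) ^ 2)⁻¹ : ℝ) : ℂ) =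
      ((t - x + Complex.I) * ((t : ℂ) - x - Complex.I))⁻¹ := by
    push_cast
    congr 1
    linear_combination Complex.I_sq
  apply mul_left_cancel₀ hs
  calc (t - x) * (f t * conj (kernel E x t) / ((‖E t‖ ^ 2 : ℝ) : ℂ))
      = (2 * Real.pi * Complex.I)⁻¹ * (E x * (f t / E t) - conj (E x) * (f t / conj (E t))) := by
        rw [hnorm, mul_div_assoc', mul_left_comm, hker]
        field_simp
    _ = (2 * Real.pi * Complex.I)⁻¹ *
          ((t - x) * (cauchyNum E f x t / (E t * (t - x + Complex.I))) -
          (t - x) * conj (cauchyNum E (sharp f) x t / (E t * (t - x + Complex.I))) +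
          (t - x) * (2 * Complex.I * f x * ((1 + (t - x) ^ 2)⁻¹ : ℝ))) := by
        rw [hquot, hquot', hpoisson]
        field_simp
        ring
    _ = _ := by ring

theorem integrable_inv_one_add_sub_sq (x : ℝ) : Integrable fun t : ℝ ↦ (1 + (t - x) ^ 2)⁻¹ :=
  integrable_inv_one_add_sq.comp_sub_right x

theorem integral_inv_one_add_sub_sq (x : ℝ) : ∫ t : ℝ, (1 + (t - x) ^ 2)⁻¹ = Real.pi := by
  rw [integral_sub_right_eq_self (fun t : ℝ ↦ (1 + t ^ 2)⁻¹) x, integral_univ_inv_one_add_sq]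

theorem inner_kernel (hE : HermiteBiehler E) (hf : f ∈ space E) (x : ℝ) :
    inner E f (kernel E x) = f x := by
  by_cases hx : E x = 0
  · simp [inner, kernel_eq_zero hE.1 hx, eq_zero_of_mem_space hE hf hx]
  have hf' := sharp_mem_space hE.1.continuous hf
  let q : ℝ → ℂ := fun t ↦ cauchyNum E f x t / (E t * (t - x + Complex.I))
  let q' : ℝ → ℂ := fun t ↦ cauchyNum E (sharp f) x t / (E t * (t - x + Complex.I))
  have hq : Integrable q := integrable_cauchyNum_div hE hf hx
  have hq' : Integrable fun t ↦ conj (q' t) :=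
    Complex.conjLIE.integrable_comp_iff.2 (integrable_cauchyNum_div hE hf' hx)
  have hpoisson : Integrable fun t : ℝ ↦ 2 * Complex.I * f x * (((1 + (t - x) ^ 2)⁻¹ : ℝ) : ℂ) :=
    (integrable_inv_one_add_sub_sq x).ofReal.const_mul _
  calc inner E f (kernel E x)
      = ∫ t : ℝ, (2 * Real.pi * Complex.I)⁻¹ *
          (q t - conj (q' t) + 2 * Complex.I * f x * ((1 + (t - x) ^ 2)⁻¹ : ℝ)) := by
        refine integral_congr_ae ?_
        filter_upwards [hE.ae_ne_zero, Measure.ae_ne volume x] with t ht htx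
        exact mul_conj_kernel_div f ht htx
    _ = (2 * Real.pi * Complex.I)⁻¹ * ((∫ t, q t) - conj (∫ t, q' t) +
          2 * Complex.I * f x * ((∫ t : ℝ, (1 + (t - x) ^ 2)⁻¹ : ℝ) : ℂ)) := by
        rw [integral_const_mul, integral_add (by exact hq.sub hq') hpoisson, integral_sub hq hq',
          integral_conj, integral_const_mul, integral_complex_ofReal]
    _ = (2 * Real.pi * Complex.I)⁻¹ * (2 * Complex.I * f x * Real.pi) := by
        rw [show ∫ t, q t = 0 from integral_cauchyNum_div hE hf hx,
          show ∫ t, q' t = 0 from integral_cauchyNum_div hE hf' hx, integral_inv_one_add_sub_sq]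
        simp
    _ = f x := by
        field_simp

theorem integral_mul_div_eq_zero (hE : HermiteBiehler E) (hF : HermiteBiehler F)
    (hf : f ∈ space E) (hg : g ∈ space F) : ∫ t : ℝ, (f * g) t / (E * F) t = 0 := by
  obtain ⟨hfd, hfL, hfT, -⟩ := (mem_space_iff hE.1.continuous).1 hf
  obtain ⟨hgd, hgL, hgT, -⟩ := (mem_space_iff hF.1.continuous).1 hg
  refine integral_div_eq_zero (hfd.mul hgd) (hE.1.mul hF.1)
    (fun z hz ↦ (hE.mul hF).ne_zero hz) ?_ ?_
  · simpa only [Pi.mul_apply, mul_div_mul_comm] using hfT.mul hgT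
  · simp only [Pi.mul_apply, mul_div_mul_comm]
    exact hfL.integrable_mul hgL

end Reproducing

section Phase

variable {G : ℂ → ℂ} {φ : ℝ → ℝ} {α x y : ℝ} {m n : ℤ}

theorem conj_eq_of_isPhaseFunction (hφ : IsPhaseFunction G φ) (hx : φ x = n * Real.pi + α) :
    conj (G x) = G x * Complex.exp (2 * Complex.I * α) := by
  have hreal : conj (G x) * Complex.exp (-(Complex.I * (φ x : ℂ))) =
      G x * Complex.exp (Complex.I * φ x) := by
    simpa [← Complex.exp_conj] using Complex.conj_eq_iff_im.2 (hφ.2.2 x)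
  have hexp : Complex.exp (2 * Complex.I * α) =
      Complex.exp (Complex.I * φ x) * Complex.exp (Complex.I * φ x) := by
    rw [← Complex.exp_add, Complex.exp_eq_exp_iff_exists_int, hx]
    refine ⟨-n, ?_⟩
    push_cast
    ring
  rw [hexp, ← mul_assoc, ← hreal, mul_assoc, ← Complex.exp_add, neg_add_cancel, Complex.exp_zero,
    mul_one]

theorem kernel_eq_zero_of_isPhaseFunction (hφ : IsPhaseFunction G φ)
    (hx : φ x = m * Real.pi + α) (hy : φ y = n * Real.pi + α) (hmn : m ≠ n) :
    kernel G x y = 0 := by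
  have hxy : (y : ℂ) - x ≠ 0 := by
    refine sub_ne_zero.2 (Complex.ofReal_injective.ne fun h ↦ hmn ?_)
    rw [h, hx] at hy
    exact_mod_cast mul_right_cancel₀ Real.pi_ne_zero (add_right_cancel hy)
  apply mul_left_cancel₀ hxy
  rw [sub_mul_kernel, kernelNum_ofReal, sharp_ofReal, conj_eq_of_isPhaseFunction hφ hx,
    conj_eq_of_isPhaseFunction hφ hy]
  ring

end Phase

open scoped InnerProductSpace

section HilbertSpace

variable {𝕜 H ι : Type*} [RCLike 𝕜] [NormedAddCommGroup H] [InnerProductSpace 𝕜 H]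
  {e : ι → H} {x : H}

theorem inner_eq_zero_of_mem_closure_span {S : Set H} {y : H} (hx : ∀ w ∈ S, ⟪w, x⟫_𝕜 = 0)
    (hy : y ∈ (Submodule.span 𝕜 S).topologicalClosure) : ⟪y, x⟫_𝕜 = 0 := by
  have hle : (Submodule.span 𝕜 S).topologicalClosure ≤ (𝕜 ∙ x)ᗮ := by
    refine Submodule.topologicalClosure_minimal _ ?_ (Submodule.isClosed_orthogonal _)
    rw [Submodule.span_le]
    exact fun w hw ↦ Submodule.mem_orthogonal_singleton_iff_inner_left.2 (hx w hw)
  exact Submodule.mem_orthogonal_singleton_iff_inner_left.1 (hle hy)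

theorem hasSum_inner_smul_of_orthonormal [CompleteSpace H] (he : Orthonormal 𝕜 e)
    (hx : x ∈ (Submodule.span 𝕜 (Set.range e)).topologicalClosure) :
    HasSum (fun i ↦ ⟪e i, x⟫_𝕜 • e i) x := by
  obtain ⟨w, b, hw, hb⟩ := he.toSubtypeRange.exists_hilbertBasis_extension
  let g : ι → w := fun i ↦ ⟨e i, hw ⟨i, rfl⟩⟩
  have hg : Function.Injective g := fun i j hij ↦
    he.linearIndependent.injective (congrArg Subtype.val hij)
  have hzero : ∀ i ∉ Set.range g, ⟪(i : H), x⟫_𝕜 • (i : H) = 0 := by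
    intro i hi
    rw [← inner_conj_symm, inner_eq_zero_of_mem_closure_span _ hx, map_zero, zero_smul]
    rintro _ ⟨j, rfl⟩
    simpa only [hb] using b.orthonormal.2 (i := g j) (j := i) fun h ↦ hi ⟨j, h⟩
  have hsum := b.hasSum_repr x
  simp_rw [b.repr_apply_apply, hb] at hsum
  exact (hg.hasSum_iff hzero).2 hsum

theorem hasSum_inner_smul_of_pairwise_orthogonal [CompleteSpace H]
    (horth : Pairwise fun i j ↦ ⟪e i, e j⟫_𝕜 = 0) (hnorm : ∀ i, e i ≠ 0 → ‖e i‖ = 1)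
    (hx : x ∈ (Submodule.span 𝕜 (Set.range e)).topologicalClosure) :
    HasSum (fun i ↦ ⟪e i, x⟫_𝕜 • e i) x := by
  let s : Set ι := {i | e i ≠ 0}
  have hortho : Orthonormal 𝕜 fun i : s ↦ e i :=
    ⟨fun i ↦ hnorm i i.2, fun i j hij ↦ horth fun h ↦ hij (Subtype.ext h)⟩
  have hspan : Submodule.span 𝕜 (Set.range e) ≤ Submodule.span 𝕜 (Set.range fun i : s ↦ e i) := by
    rw [Submodule.span_le]
    rintro _ ⟨i, rfl⟩
    by_cases hi : e i = 0
    · rw [hi]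
      exact Submodule.zero_mem _
    · exact Submodule.subset_span ⟨⟨i, hi⟩, rfl⟩
  have hsum := hasSum_inner_smul_of_orthonormal hortho (Submodule.topologicalClosure_mono hspan hx)
  refine (hasSum_subtype_iff_of_support_subset (s := s) fun i hi hzero ↦ hi ?_).1 hsum
  rw [hzero, smul_zero]

theorem hasSum_norm_inner_sq (hx : HasSum (fun i ↦ ⟪e i, x⟫_𝕜 • e i) x) :
    HasSum (fun i ↦ ‖⟪e i, x⟫_𝕜‖ ^ 2) (‖x‖ ^ 2) := by
  have hterm : ∀ i, ‖⟪e i, x⟫_𝕜‖ ^ 2 = RCLike.re ⟪x, ⟪e i, x⟫_𝕜 • e i⟫_𝕜 := fun i ↦ by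
    rw [inner_smul_right, inner_mul_symm_re_eq_norm, norm_mul, norm_inner_symm x, sq]
  simp only [hterm, ← inner_self_eq_norm_sq (𝕜 := 𝕜)]
  exact RCLike.hasSum_re 𝕜 ((innerSL 𝕜 x).hasSum hx)

theorem hasSum_inner_smul_zero_of_mem_orthogonal [CompleteSpace H] {V : Submodule 𝕜 H} {v : ι → H}
    (hx : HasSum (fun i ↦ ⟪e i, x⟫_𝕜 • e i) x) (hv : ∀ i, v i ∈ V) (hev : ∀ i, e i - v i ∈ Vᗮ)
    (hxV : x ∈ Vᗮ) : HasSum (fun i ↦ ⟪e i, x⟫_𝕜 • v i) 0 := by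
  have : CompleteSpace V.topologicalClosure := V.isClosed_topologicalClosure.completeSpace_coe
  rw [← V.orthogonal_closure] at hxV hev
  have hproj : ∀ i, V.topologicalClosure.starProjection (e i) = v i := fun i ↦
    Submodule.eq_starProjection_of_mem_orthogonal (V.le_topologicalClosure (hv i)) (hev i)
  have hproj_x : V.topologicalClosure.starProjection x = 0 :=
    (Submodule.starProjection_apply_eq_zero_iff _).2 hxV
  simpa only [map_smul, hproj, hproj_x] using V.topologicalClosure.starProjection.hasSum hx

end HilbertSpace

section Embedding

variable {E : ℂ → ℂ}

/-- The de Branges space of `E` as a vector space of entire functions. -/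
noncomputable def deBrangesSpace (hE : HermiteBiehler E) : Submodule ℂ (ℂ → ℂ) where
  carrier := space E
  add_mem' := add_mem_space hE.1.continuous
  zero_mem' := zero_mem_space hE.1.continuous
  smul_mem' c _ := smul_mem_space hE.1.continuous c

theorem memLp_div (hE : HermiteBiehler E) (f : deBrangesSpace hE) :
    MemLp (fun t : ℝ ↦ (f : ℂ → ℂ) t / E t) 2 :=
  ((mem_space_iff hE.1.continuous).1 f.2).2.1

/-- The isometric embedding `f ↦ f / E` of the de Branges space of `E` into `L²(ℝ)`. -/
noncomputable def toL2 (hE : HermiteBiehler E) :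
    deBrangesSpace hE →ₗ[ℂ] Lp ℂ 2 (volume : Measure ℝ) where
  toFun f := (memLp_div hE f).toLp _
  map_add' f g := by
    rw [← MemLp.toLp_add]
    exact MemLp.toLp_congr _ _ (ae_of_all _ fun t ↦ add_div _ _ _)
  map_smul' c f := by
    rw [RingHom.id_apply, ← MemLp.toLp_const_smul]
    exact MemLp.toLp_congr _ _ (ae_of_all _ fun t ↦ mul_div_assoc _ _ _)

theorem enorm_toL2_sq (hE : HermiteBiehler E) (f : deBrangesSpace hE) :
    ‖toL2 hE f‖ₑ ^ 2 = normSq E f := by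
  rw [normSq_eq_eLpNorm_sq, toL2, LinearMap.coe_mk, AddHom.coe_mk, Lp.enorm_toLp]

theorem inner_toL2 (hE : HermiteBiehler E) (f g : deBrangesSpace hE) :
    ⟪toL2 hE g, toL2 hE f⟫_ℂ = inner E f g := by
  rw [L2.inner_def]
  refine integral_congr_ae ?_
  filter_upwards [(memLp_div hE f).coeFn_toLp, (memLp_div hE g).coeFn_toLp] with t hf hg
  rw [toL2, LinearMap.coe_mk, AddHom.coe_mk, hf, hg, RCLike.inner_apply, map_div₀,
    div_mul_div_comm, Complex.mul_conj, Complex.normSq_eq_norm_sq]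

/-- The reproducing kernel `K_E(x, ·)` at a real point, as an element of the de Branges space. -/
noncomputable def reproducingKernel (hE : HermiteBiehler E) (x : ℝ) : deBrangesSpace hE :=
  ⟨kernel E x, kernel_mem_space hE x⟩

theorem inner_toL2_reproducingKernel (hE : HermiteBiehler E) (f : deBrangesSpace hE) (x : ℝ) :
    ⟪toL2 hE (reproducingKernel hE x), toL2 hE f⟫_ℂ = (f : ℂ → ℂ) x := by
  rw [inner_toL2]
  exact inner_kernel hE f.2 x

theorem kernel_self (hE : HermiteBiehler E) (x : ℝ) :
    kernel E x x = ((‖toL2 hE (reproducingKernel hE x)‖ ^ 2 : ℝ) : ℂ) := by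
  have h := inner_toL2_reproducingKernel hE (reproducingKernel hE x) x
  rw [inner_self_eq_norm_sq_to_K] at h
  exact_mod_cast h.symm

theorem sqrt_kernel_self_re (hE : HermiteBiehler E) (x : ℝ) :
    √(kernel E x x).re = ‖toL2 hE (reproducingKernel hE x)‖ := by
  rw [kernel_self hE, Complex.ofReal_re, Real.sqrt_sq (norm_nonneg _)]

theorem sqrt_kernel_self_re_mul_self (hE : HermiteBiehler E) (x : ℝ) :
    (√(kernel E x x).re : ℂ) * (√(kernel E x x).re : ℂ) = kernel E x x := by
  rw [sqrt_kernel_self_re hE, kernel_self hE, sq, Complex.ofReal_mul]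

/-- The normalized reproducing kernel `K_E(x, ·) / √K_E(x, x)`, as an element of `L²(ℝ)`; it is `0`
when `K_E(x, ·) = 0`. -/
noncomputable def unitKernel (hE : HermiteBiehler E) (x : ℝ) : Lp ℂ 2 (volume : Measure ℝ) :=
  (√(kernel E x x).re : ℂ)⁻¹ • toL2 hE (reproducingKernel hE x)

theorem inner_unitKernel (hE : HermiteBiehler E) (f : deBrangesSpace hE) (x : ℝ) :
    ⟪unitKernel hE x, toL2 hE f⟫_ℂ = (f : ℂ → ℂ) x / (√(kernel E x x).re : ℂ) := by
  rw [unitKernel, inner_smul_left, inner_toL2_reproducingKernel, map_inv₀, Complex.conj_ofReal,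
    div_eq_inv_mul]

theorem norm_unitKernel (hE : HermiteBiehler E) {x : ℝ} (hx : unitKernel hE x ≠ 0) :
    ‖unitKernel hE x‖ = 1 := by
  have hne : toL2 hE (reproducingKernel hE x) ≠ 0 := fun h ↦ hx (by rw [unitKernel, h, smul_zero])
  rw [unitKernel, sqrt_kernel_self_re hE]
  exact norm_smul_inv_norm hne

theorem toL2_reproducingKernel (hE : HermiteBiehler E) (x : ℝ) :
    toL2 hE (reproducingKernel hE x) = (√(kernel E x x).re : ℂ) • unitKernel hE x := by
  by_cases h : toL2 hE (reproducingKernel hE x) = 0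
  · rw [unitKernel, h, smul_zero, smul_zero]
  · rw [unitKernel, smul_inv_smul₀]
    rw [sqrt_kernel_self_re hE]
    exact_mod_cast norm_ne_zero_iff.2 h

theorem inner_unitKernel_unitKernel (hE : HermiteBiehler E) {x y : ℝ} (h : kernel E y x = 0) :
    ⟪unitKernel hE x, unitKernel hE y⟫_ℂ = 0 := by
  rw [unitKernel.eq_1 hE y, inner_smul_right, inner_unitKernel]
  simp [reproducingKernel, h]

variable {ι : Type*} {lam : ι → ℝ}

theorem exists_toL2_mem_span_unitKernel (hE : HermiteBiehler E) {f : ℂ → ℂ}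
    (hf : f ∈ Submodule.span ℂ (Set.range fun n ↦ kernel E (lam n))) :
    ∃ f' : deBrangesSpace hE, (f' : ℂ → ℂ) = f ∧
      toL2 hE f' ∈ Submodule.span ℂ (Set.range fun n ↦ unitKernel hE (lam n)) := by
  let U := Submodule.span ℂ (Set.range fun n ↦ unitKernel hE (lam n))
  have hle : Submodule.span ℂ (Set.range fun n ↦ kernel E (lam n)) ≤
      (U.comap (toL2 hE)).map (deBrangesSpace hE).subtype := by
    rw [Submodule.span_le]
    rintro _ ⟨n, rfl⟩
    refine ⟨reproducingKernel hE (lam n), ?_, rfl⟩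
    rw [SetLike.mem_coe, Submodule.mem_comap, toL2_reproducingKernel]
    exact U.smul_mem _ (Submodule.subset_span ⟨n, rfl⟩)
  obtain ⟨f', hf', rfl⟩ := hle hf
  exact ⟨f', rfl, hf'⟩

theorem toL2_mem_closure_span_unitKernel (hE : HermiteBiehler E)
    (hcomplete : IsCompleteSystem E fun n ↦ kernel E (lam n)) (f : deBrangesSpace hE) :
    toL2 hE f ∈
      (Submodule.span ℂ (Set.range fun n ↦ unitKernel hE (lam n))).topologicalClosure := by
  rw [← SetLike.mem_coe, Submodule.topologicalClosure_coe, EMetric.mem_closure_iff]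
  intro ε hε
  obtain ⟨g, hg, hfg⟩ := hcomplete f f.2 (ε ^ 2) (by positivity)
  obtain ⟨g', rfl, hg'⟩ := exists_toL2_mem_span_unitKernel hE hg
  refine ⟨toL2 hE g', hg', ?_⟩
  rw [edist_eq_enorm_sub, ← map_sub]
  refine lt_of_pow_lt_pow_left' 2 ?_
  rw [enorm_toL2_sq]
  exact hfg

theorem hasSum_inner_smul_unitKernel (hE : HermiteBiehler E)
    (horth : Pairwise fun m n ↦ kernel E (lam m) (lam n) = 0)
    (hcomplete : IsCompleteSystem E fun n ↦ kernel E (lam n)) (f : deBrangesSpace hE) :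
    HasSum (fun n ↦ ⟪unitKernel hE (lam n), toL2 hE f⟫_ℂ • unitKernel hE (lam n)) (toL2 hE f) :=
  hasSum_inner_smul_of_pairwise_orthogonal
    (fun _ _ hmn ↦ inner_unitKernel_unitKernel hE (horth hmn.symm)) (fun _ ↦ norm_unitKernel hE)
    (toL2_mem_closure_span_unitKernel hE hcomplete f)

end Embedding

section Multiplier

variable {A B C D E F G f g : ℂ → ℂ} {ι : Type*} {lam : ι → ℝ}

/-- Multiplication by `C` maps the de Branges space of `A` isometrically into that of `G`. The
isometry is encoded by the equality of the weights `|C / G|` and `1 / |A|` on the real axis. -/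
structure IsIsometricMultiplier (A G C : ℂ → ℂ) : Prop where
  mul_mem_space : ∀ f ∈ space A, f * C ∈ space G
  ae_norm_div_eq : ∀ᵐ t : ℝ, ‖C t / G t‖ = ‖A t‖⁻¹

theorem isIsometricMultiplier_right (hE : HermiteBiehler E) (hF : HermiteBiehler F) :
    IsIsometricMultiplier E (E * F) F where
  mul_mem_space _ hf := mul_mem_space_self hE.1.continuous hF hf
  ae_norm_div_eq := by
    filter_upwards [hF.ae_ne_zero] with t ht
    rw [Pi.mul_apply, div_mul_cancel_right₀ ht, norm_inv]

theorem isIsometricMultiplier_sharp_left (hE : HermiteBiehler E) (hF : HermiteBiehler F) :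
    IsIsometricMultiplier F (E * F) (sharp E) where
  mul_mem_space _ hg := mul_sharp_mem_space hE hF.1.continuous hg
  ae_norm_div_eq := by
    filter_upwards [hE.ae_ne_zero] with t ht
    rw [Pi.mul_apply, norm_div, sharp_ofReal, RCLike.norm_conj, norm_mul,
      div_mul_cancel_left₀ (norm_ne_zero_iff.2 ht)]

namespace IsIsometricMultiplier

theorem normSq_mul (h : IsIsometricMultiplier A G C) (f : ℂ → ℂ) :
    normSq G (f * C) = normSq A f := by
  refine lintegral_congr_ae ?_
  filter_upwards [h.ae_norm_div_eq] with t ht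
  rw [Pi.mul_apply, mul_div_assoc, ← ofReal_norm, ← ofReal_norm, norm_mul, ht, norm_div,
    div_eq_mul_inv]

theorem inner_mul (h : IsIsometricMultiplier A G C) (f g : ℂ → ℂ) :
    inner G (f * C) (g * C) = inner A f g := by
  refine integral_congr_ae ?_
  filter_upwards [h.ae_norm_div_eq] with t ht
  have hweight : C t * conj (C t) / ((‖G t‖ ^ 2 : ℝ) : ℂ) = ((‖A t‖ ^ 2 : ℝ) : ℂ)⁻¹ := by
    rw [Complex.mul_conj, Complex.normSq_eq_norm_sq, ← Complex.ofReal_div, ← div_pow, ← norm_div,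
      ht, inv_pow, Complex.ofReal_inv]
  rw [Pi.mul_apply, Pi.mul_apply, map_mul, mul_mul_mul_comm, mul_div_assoc, hweight,
    ← div_eq_mul_inv]

/-- The isometric embedding `f ↦ f C / G` of the de Branges space of `A` into `L²(ℝ)`. -/
noncomputable def mulToL2 (h : IsIsometricMultiplier A G C) (hA : HermiteBiehler A)
    (hG : HermiteBiehler G) : deBrangesSpace hA →ₗ[ℂ] Lp ℂ 2 (volume : Measure ℝ) :=
  toL2 hG ∘ₗ (LinearMap.mulRight ℂ C).restrict fun f (hf : f ∈ deBrangesSpace hA) ↦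
    (h.mul_mem_space f hf : f * C ∈ deBrangesSpace hG)

theorem enorm_mulToL2_sq (h : IsIsometricMultiplier A G C) (hA : HermiteBiehler A)
    (hG : HermiteBiehler G) (f : deBrangesSpace hA) :
    ‖h.mulToL2 hA hG f‖ₑ ^ 2 = normSq A f :=
  (enorm_toL2_sq hG _).trans (h.normSq_mul f)

theorem inner_mulToL2 (h : IsIsometricMultiplier A G C) (hA : HermiteBiehler A)
    (hG : HermiteBiehler G) (f g : deBrangesSpace hA) :
    ⟪h.mulToL2 hA hG g, h.mulToL2 hA hG f⟫_ℂ = inner A f g :=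
  (inner_toL2 hG _ _).trans (h.inner_mul f g)

end IsIsometricMultiplier

/-- The vector `conj C(x) K_A(x, ·) / √K_G(x, x)`, which represents the functional
`f ↦ f(x) C(x) / √K_G(x, x)` on the de Branges space of `A`. -/
noncomputable def samplingFunction (G A C : ℂ → ℂ) (x : ℝ) : ℂ → ℂ :=
  (conj (C x) / (√(kernel G x x).re : ℂ)) • kernel A x

theorem samplingFunction_mem_space (G : ℂ → ℂ) (hA : HermiteBiehler A) (C : ℂ → ℂ) (x : ℝ) :
    samplingFunction G A C x ∈ deBrangesSpace hA :=
  smul_mem_space hA.1.continuous _ (kernel_mem_space hA x)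

theorem inner_smul_right_conj (E : ℂ → ℂ) (c : ℂ) (f g : ℂ → ℂ) :
    inner E f (c • g) = conj c * inner E f g := by
  rw [inner, inner, ← integral_const_mul]
  congr 1 with t
  rw [Pi.smul_apply, smul_eq_mul, map_mul, mul_left_comm, mul_div_assoc]

theorem inner_samplingFunction (G : ℂ → ℂ) (hA : HermiteBiehler A) (C : ℂ → ℂ) (hf : f ∈ space A)
    (x : ℝ) : inner A f (samplingFunction G A C x) = f x * C x / (√(kernel G x x).re : ℂ) := by
  rw [samplingFunction, inner_smul_right_conj, inner_kernel hA hf, map_div₀, Complex.conj_conj,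
    Complex.conj_ofReal, div_mul_eq_mul_div, mul_comm (C x)]

theorem IsIsometricMultiplier.inner_unitKernel_mulToL2 (h : IsIsometricMultiplier A G C)
    (hA : HermiteBiehler A) (hG : HermiteBiehler G) (f : deBrangesSpace hA) (x : ℝ) :
    ⟪unitKernel hG x, h.mulToL2 hA hG f⟫_ℂ = inner A f (samplingFunction G A C x) :=
  (inner_unitKernel hG _ x).trans (inner_samplingFunction G hA C f.2 x).symm

theorem IsIsometricMultiplier.hasSum_inner_smul_unitKernel (h : IsIsometricMultiplier A G C)
    (hA : HermiteBiehler A) (hG : HermiteBiehler G)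
    (horth : Pairwise fun m n ↦ kernel G (lam m) (lam n) = 0)
    (hcomplete : IsCompleteSystem G fun n ↦ kernel G (lam n)) (f : deBrangesSpace hA) :
    HasSum (fun n ↦ ⟪unitKernel hG (lam n), h.mulToL2 hA hG f⟫_ℂ • unitKernel hG (lam n))
      (h.mulToL2 hA hG f) :=
  DeBranges.hasSum_inner_smul_unitKernel hG horth hcomplete _

theorem isParsevalFrame_samplingFunction (h : IsIsometricMultiplier A G C) (hA : HermiteBiehler A)
    (hG : HermiteBiehler G) (horth : Pairwise fun m n ↦ kernel G (lam m) (lam n) = 0)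
    (hcomplete : IsCompleteSystem G fun n ↦ kernel G (lam n)) :
    IsParsevalFrame A fun n ↦ samplingFunction G A C (lam n) := by
  refine ⟨fun n ↦ samplingFunction_mem_space G hA C _, fun f hf ↦ ?_⟩
  let f' : deBrangesSpace hA := ⟨f, hf⟩
  have hsum := hasSum_norm_inner_sq (h.hasSum_inner_smul_unitKernel hA hG horth hcomplete f')
  calc ∑' n, ‖inner A f (samplingFunction G A C (lam n))‖ₑ ^ 2
      = ∑' n, ENNReal.ofReal (‖⟪unitKernel hG (lam n), h.mulToL2 hA hG f'⟫_ℂ‖ ^ 2) := by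
        simp only [h.inner_unitKernel_mulToL2, ENNReal.ofReal_pow (norm_nonneg _), ofReal_norm, f']
    _ = ENNReal.ofReal (‖h.mulToL2 hA hG f'‖ ^ 2) := by
        rw [← ENNReal.ofReal_tsum_of_nonneg (fun _ ↦ sq_nonneg _) hsum.summable, hsum.tsum_eq]
    _ = normSq A f := by
        rw [ENNReal.ofReal_pow (norm_nonneg _), ofReal_norm, h.enorm_mulToL2_sq]

theorem hasSumIn_of_hasSum_mulToL2 (h : IsIsometricMultiplier A G C) (hA : HermiteBiehler A)
    (hG : HermiteBiehler G) {u : ι → deBrangesSpace hA} {s : deBrangesSpace hA}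
    (hsum : HasSum (fun i ↦ h.mulToL2 hA hG (u i)) (h.mulToL2 hA hG s)) :
    HasSumIn A (fun i ↦ (u i : ℂ → ℂ)) s := by
  refine ⟨fun i ↦ (u i).2, s.2, ?_⟩
  have hnorm : ∀ T : Finset ι, normSq A (∑ i ∈ T, (u i : ℂ → ℂ) - s) =
      ‖∑ i ∈ T, h.mulToL2 hA hG (u i) - h.mulToL2 hA hG s‖ₑ ^ 2 := fun T ↦ by
    rw [← map_sum, ← map_sub, h.enorm_mulToL2_sq, Submodule.coe_sub, Submodule.coe_sum]
  have hlim : Tendsto (fun T : Finset ι ↦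
      ‖∑ i ∈ T, h.mulToL2 hA hG (u i) - h.mulToL2 hA hG s‖ₑ) atTop (𝓝 0) :=
    tendsto_iff_enorm_sub_tendsto_zero.1 hsum
  simpa only [hnorm, zero_pow two_ne_zero] using ENNReal.Tendsto.pow (n := 2) hlim

theorem synthesisAnalysisZero_samplingFunction (hAC : IsIsometricMultiplier A G C)
    (hBD : IsIsometricMultiplier B G D) (hA : HermiteBiehler A) (hB : HermiteBiehler B)
    (hG : HermiteBiehler G) (horth : Pairwise fun m n ↦ kernel G (lam m) (lam n) = 0)
    (hcomplete : IsCompleteSystem G fun n ↦ kernel G (lam n))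
    (hzero : ∀ f ∈ space A, ∀ g ∈ space B, inner G (f * C) (g * D) = 0) :
    SynthesisAnalysisZero A B (fun n ↦ samplingFunction G A C (lam n))
      fun n ↦ samplingFunction G B D (lam n) := by
  intro f hf
  let f' : deBrangesSpace hA := ⟨f, hf⟩
  let v : ι → deBrangesSpace hB := fun n ↦ ⟨_, samplingFunction_mem_space G hB D (lam n)⟩
  let V := LinearMap.range (hBD.mulToL2 hB hG)
  have hproj : ∀ n, unitKernel hG (lam n) - hBD.mulToL2 hB hG (v n) ∈ Vᗮ := by
    rintro n
    rw [Submodule.mem_orthogonal']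
    rintro _ ⟨g, rfl⟩
    rw [inner_sub_left, hBD.inner_unitKernel_mulToL2, hBD.inner_mulToL2, sub_self]
  have hf_orth : hAC.mulToL2 hA hG f' ∈ Vᗮ := by
    rw [Submodule.mem_orthogonal]
    rintro _ ⟨g, rfl⟩
    exact (inner_toL2 hG _ _).trans (hzero f hf g g.2)
  have hsum := hasSum_inner_smul_zero_of_mem_orthogonal
    (hAC.hasSum_inner_smul_unitKernel hA hG horth hcomplete f')
    (fun n ↦ LinearMap.mem_range_self _ (v n)) hproj hf_orth
  simp only [hAC.inner_unitKernel_mulToL2, ← map_smul] at hsum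
  exact hasSumIn_of_hasSum_mulToL2 hBD hB hG (s := 0) (by simpa only [map_zero] using hsum)

end Multiplier

section Orthogonality

variable {E F f g : ℂ → ℂ}

theorem inner_mul_sharp_mul (hE : HermiteBiehler E) (hF : HermiteBiehler F) (hf : f ∈ space E)
    (hg : g ∈ space F) : inner (E * F) (g * sharp E) (f * F) = 0 := by
  rw [← integral_mul_div_eq_zero hE hF (sharp_mem_space hE.1.continuous hf) hg]
  refine integral_congr_ae ?_
  filter_upwards [hE.ae_ne_zero, hF.ae_ne_zero] with t hEt hFt
  have hnorm : ((‖(E * F) t‖ ^ 2 : ℝ) : ℂ) = E t * F t * (conj (E t) * conj (F t)) := by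
    rw [← map_mul, Complex.mul_conj, Complex.normSq_eq_norm_sq, Pi.mul_apply]
  have hEt' : conj (E t) ≠ 0 := (map_ne_zero conj).2 hEt
  have hFt' : conj (F t) ≠ 0 := (map_ne_zero conj).2 hFt
  rw [hnorm]
  simp only [Pi.mul_apply, sharp_ofReal, map_mul]
  field_simp

theorem conj_inner (E f g : ℂ → ℂ) : conj (inner E f g) = inner E g f := by
  rw [inner, inner, ← integral_conj]
  congr 1 with t
  rw [map_div₀, map_mul, Complex.conj_conj, Complex.conj_ofReal, mul_comm]

theorem inner_mul_mul_sharp (hE : HermiteBiehler E) (hF : HermiteBiehler F) (hf : f ∈ space E)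
    (hg : g ∈ space F) : inner (E * F) (f * F) (g * sharp E) = 0 := by
  rw [← conj_inner, inner_mul_sharp_mul hE hF hf hg, map_zero]

end Orthogonality

section Frames

variable {A B C D E F G f : ℂ → ℂ}

theorem inner_smul_samplingFunction (hA : HermiteBiehler A) (hG : HermiteBiehler G)
    (hf : f ∈ space A) (x : ℝ) :
    inner A f (samplingFunction G A C x) • samplingFunction G B D x =
      fun z ↦ f x * C x * (conj (D x) * kernel B x z / kernel G x x) := by
  ext z
  rw [inner_samplingFunction G hA C hf, samplingFunction, Pi.smul_apply, Pi.smul_apply, smul_eq_mul,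
    smul_eq_mul, div_mul_eq_mul_div (conj (D x)), div_mul_div_comm,
    sqrt_kernel_self_re_mul_self hG, mul_div_assoc]

theorem frameE_eq_samplingFunction (E F : ℂ → ℂ) (lam : ℤ → ℝ) :
    frameE E F lam = fun n ↦ samplingFunction (E * F) E F (lam n) := by
  ext n z
  exact (div_mul_eq_mul_div _ _ _).symm

theorem frameF_eq_samplingFunction (E F : ℂ → ℂ) (lam : ℤ → ℝ) :
    frameF E F lam = fun n ↦ samplingFunction (E * F) F (sharp E) (lam n) := by
  ext n z
  rw [frameF, samplingFunction, sharp_ofReal, Complex.conj_conj]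
  exact (div_mul_eq_mul_div _ _ _).symm

end Frames

end DeBranges

open DeBranges in
theorem mainTheorem6_general {ι : Type*} {E F : ℂ → ℂ} (hE : HermiteBiehler E)
    (hF : HermiteBiehler F) {lam : ι → ℝ}
    (horth : Pairwise fun m n ↦ kernel (E * F) (lam m) (lam n) = 0)
    (hcomplete : IsCompleteSystem (E * F) fun n ↦ kernel (E * F) (lam n)) :
    (∀ f ∈ space E, HasSumIn F (fun n z ↦ f (lam n) * F (lam n) *
      (E (lam n) * kernel F (lam n) z / kernel (E * F) (lam n) (lam n))) 0) ∧
    (∀ g ∈ space F, HasSumIn E (fun n z ↦ g (lam n) * sharp E (lam n) *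
      (conj (F (lam n)) * kernel E (lam n) z / kernel (E * F) (lam n) (lam n))) 0) ∧
    IsParsevalFrame E (fun n ↦ samplingFunction (E * F) E F (lam n)) ∧
    IsParsevalFrame F (fun n ↦ samplingFunction (E * F) F (sharp E) (lam n)) ∧
    IsOrthogonalPair E F (fun n ↦ samplingFunction (E * F) E F (lam n))
      (fun n ↦ samplingFunction (E * F) F (sharp E) (lam n)) := by
  have hG := hE.mul hF
  have hmulF := isIsometricMultiplier_right hE hF
  have hmulE := isIsometricMultiplier_sharp_left hE hF
  have hEF := synthesisAnalysisZero_samplingFunction hmulF hmulE hE hF hG horth hcomplete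
    fun f hf g hg ↦ inner_mul_mul_sharp hE hF hf hg
  have hFE := synthesisAnalysisZero_samplingFunction hmulE hmulF hF hE hG horth hcomplete
    fun g hg f hf ↦ inner_mul_sharp_mul hE hF hf hg
  refine ⟨fun f hf ↦ ?_, fun g hg ↦ ?_,
    isParsevalFrame_samplingFunction hmulF hE hG horth hcomplete,
    isParsevalFrame_samplingFunction hmulE hF hG horth hcomplete, hEF, hFE⟩
  · simpa only [inner_smul_samplingFunction hE hG hf, sharp_ofReal, Complex.conj_conj]
      using hEF f hf
  · simpa only [inner_smul_samplingFunction hF hG hg] using hFE g hg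

theorem mainTheorem6 (E F : ℂ → ℂ)
    (hE : DeBranges.HermiteBiehler E) (hF : DeBranges.HermiteBiehler F)
    (φ : ℝ → ℝ) (hφ : DeBranges.IsPhaseFunction (E * F) φ)
    (α : ℝ) (hα : α ∈ Set.Ico 0 Real.pi)
    (lam : ℤ → ℝ) (hlam : ∀ n : ℤ, φ (lam n) = n * Real.pi + α)
    (hcomplete : DeBranges.IsCompleteSystem (E * F)
      (fun n : ℤ => DeBranges.kernel (E * F) (lam n))) :
    (∀ f ∈ DeBranges.space E,
      DeBranges.HasSumIn F
        (fun n : ℤ => fun z : ℂ =>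
          f (lam n) * F (lam n) * (E (lam n) * DeBranges.kernel F (lam n) z /
            DeBranges.kernel (E * F) (lam n) (lam n))) 0) ∧
    (∀ g ∈ DeBranges.space F,
      DeBranges.HasSumIn E
        (fun n : ℤ => fun z : ℂ =>
          g (lam n) * DeBranges.sharp E (lam n) *
            (conj (F (lam n)) * DeBranges.kernel E (lam n) z /
              DeBranges.kernel (E * F) (lam n) (lam n))) 0) ∧
    DeBranges.IsParsevalFrame E (DeBranges.frameE E F lam) ∧
    DeBranges.IsParsevalFrame F (DeBranges.frameF E F lam) ∧
    DeBranges.IsOrthogonalPair E F (DeBranges.frameE E F lam) (DeBranges.frameF E F lam) := by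
  rw [DeBranges.frameE_eq_samplingFunction, DeBranges.frameF_eq_samplingFunction]
  exact mainTheorem6_general hE hF (fun m n hmn ↦
    DeBranges.kernel_eq_zero_of_isPhaseFunction hφ (hlam m) (hlam n) hmn) hcomplete
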